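/- Let $n\ge 2$. Let $\mathcal O_n$ be the Cuntz algebra, i.e. the universal C*-algebra generated by $s_1,\dots,s_n$ with $s_i^*s_j=\delta_{ij}1$ and $\sum_{i}s_is_i^*=1$, and let $A=\mathcal O_n^{\mathbb T}$ be the fixed-point algebra of the gauge action $\gamma_z(s_i)=zs_i$ $(z\in\mathbb T)$. For $a\in A$ put $$\lambda(a)=\sum_i s_ias_i^*,\qquad \mathcal E(a)=\sum_i s_is_i^*as_is_i^*,\qquad \mathcal L(a)=\sum_i s_i^*as_i .$$ Let ${}_\lambda A_A$ be the vector space $A$ with left action $a\rhd x=\lambda(a)x$, right action $x\lhd a=xa$, left form ${}_A\langle x,y\rangle=\mathcal L(\mathcal E(xy^*))$ and right form $\langle x\mid y\rangle_A=x^*y$. A finite family $(u_k)$ is a left (right) Pimsner–Popa basis of a Hilbert module if $x=\sum_k{}_A\langle x,u_k\rangle\rhd u_k$ (resp. $x=\sum_k u_k\lhd\langle u_k\mid x\rangle_A$) for all $x$; a Hilbert module is finitely generated projective (fgp) if it has one; a fgp bimodule is a bimodule that is a fgp Hilbert module on both sides, with equivalent norms and with each action adjointable for the form of the other side. The left (right)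 Watatani index is $\sum_k\langle u_k\mid u_k\rangle_A$ for a left basis (resp. $\sum_k{}_A\langle u_k,u_k\rangle$ for a right basis), which in the cases below does not depend on the basis. $\mathrm{End}^\dagger(X)$ is the algebra of bimodular endomorphisms of $X$ that are adjointable for both forms, and a bimodule $X\neq0$ is irreducible if $\mathrm{End}^\dagger(X)=\mathbb C\,\mathrm{id}$. Then ${}_\lambda A_A$ is a fgp bimodule and: 1. The family $\{s_js_i^*\}_{i,j=1}^n$ is a left Pimsner–Popa basis of ${}_\lambda A$ and is orthonormal, ${}_A\langle s_js_i^*,s_ks_\ell^*\rangle=\delta_{jk}\delta_{i\ell}1$. Each block $A\rhd s_js_i^*$ is a fgp left Hilbert $A$-module with left Watatani index $s_is_i^*$, and summation is a unitary isomorphism $\bigoplus_{i,j}(A\rhd s_js_i^*)\cong{}_\lambda A$ of left Hilbert $A$-modules. 2. For each $i$ the sub-bimodule $(s_is_i^*)A$ of ${}_\lambda A_A$ is fgp and irreducible, with left and right Watatani index $1$, and summation is an isomorphism $\bigoplus_{i=1}^n(s_is_i^*)A\cong{}_\lambda A_A$ of bimodules that preserves both forms; in particular the summands are mutually orthogonal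 for both forms. 3. Every bimodular endomorphism of ${}_\lambda A_A$ is adjointable for both forms. There are $*$-isomorphisms $\mathrm{End}^\dagger({}_\lambda A_A)\cong\lambda[A]'\cap A\cong M_n(\mathbb C)$: here $t\in\lambda[A]'\cap A$ corresponds to left multiplication by $t$, left multiplication by $t^*$ is an adjoint of it for both forms, and $s_js_i^*$ corresponds to the matrix unit $e_{ji}$. 4. For each $i$, every nonzero $\xi\in(s_is_i^*)A$ generates this bimodule algebraically: $(s_is_i^*)A$ is the linear span of $\{\lambda(a)\,\xi\,b: a,b\in A\}$. -/

import Mathlib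

open scoped ENNReal

noncomputable section

/-! ## Hilbert bimodules over a C*-algebra -/

/-- The operations of a left module over `A` with an `A`-valued form: the left action `a ▷ x` of `A`
by linear maps, and a form `⟨x, y⟩` that is linear in `x` and conjugate-linear in `y`. -/
structure LeftModuleData (A X : Type*) [CStarAlgebra A] [AddCommGroup X] [Module ℂ X] where
  /-- the left action `a ▷ x` -/
  lsmul : A →ₐ[ℂ] Module.End ℂ X
  /-- the left form `⟨x, y⟩` -/
  linner : X →ₗ[ℂ] X →ₗ⋆[ℂ] A

/-- The operations of a right module over `A` with an `A`-valued form: the right action `x ◁ a` of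
`A` by linear maps, and a form `⟨x | y⟩` that is conjugate-linear in `x` and linear in `y`. -/
structure RightModuleData (A X : Type*) [CStarAlgebra A] [AddCommGroup X] [Module ℂ X] where
  /-- the right action `x ◁ a` -/
  rsmul : Aᵐᵒᵖ →ₐ[ℂ] Module.End ℂ X
  /-- the right form `⟨x | y⟩` -/
  rinner : X →ₗ⋆[ℂ] X →ₗ[ℂ] A

/-- The operations of an `A`-`A` bimodule with a left and a right `A`-valued form. -/
structure BimoduleData (A X : Type*) [CStarAlgebra A] [AddCommGroup X] [Module ℂ X] extends
  LeftModuleData A X, RightModuleData A X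

section General

variable {A X Y : Type*} [CStarAlgebra A] [AddCommGroup X] [Module ℂ X]
  [AddCommGroup Y] [Module ℂ Y]

namespace LeftModuleData

/-- A left Hilbert `A`-module: the form is `A`-linear in the first variable, hermitian, positive
(an element of a C*-algebra is positive iff it is of the form `b⋆ b`), definite, and the norm
`‖⟨x, x⟩‖ ^ (1/2)` is complete. -/
structure IsHilbert (M : LeftModuleData A X) : Prop where
  linner_lsmul : ∀ (a : A) (x y : X), M.linner (M.lsmul a x) y = a * M.linner x y
  star_linner : ∀ x y : X, star (M.linner x y) = M.linner y x
  linner_nonneg : ∀ x : X, ∃ b : A, M.linner x x = star b * b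
  linner_definite : ∀ x : X, M.linner x x = 0 → x = 0
  complete : ∀ u : ℕ → X,
    (∀ ε > 0, ∃ N, ∀ p ≥ N, ∀ q ≥ N, ‖M.linner (u p - u q) (u p - u q)‖ < ε) →
      ∃ x : X, ∀ ε > 0, ∃ N, ∀ p ≥ N, ‖M.linner (u p - x) (u p - x)‖ < ε

/-- A finite left Pimsner–Popa basis: `x = ∑ i, ⟨x, u i⟩ ▷ u i` for all `x`. -/
def IsBasis (M : LeftModuleData A X) {ι : Type*} [Fintype ι] (u : ι → X) : Prop :=
  ∀ x : X, ∑ i, M.lsmul (M.linner x (u i)) (u i) = x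

/-- An orthonormal family: `⟨u i, u j⟩` is `1` if `i = j` and `0` otherwise. -/
def IsOrthonormal (M : LeftModuleData A X) {ι : Type*} [DecidableEq ι] (u : ι → X) : Prop :=
  ∀ i j, M.linner (u i) (u j) = if i = j then 1 else 0

/-- Finitely generated projective left Hilbert modules. -/
def IsFgp (M : LeftModuleData A X) : Prop :=
  M.IsHilbert ∧ ∃ (k : ℕ) (u : Fin k → X), M.IsBasis u

/-- The left Watatani index, with respect to a right form `r`, is `c`: finite left Pimsner–Popa
bases `u` exist, and `∑ i, ⟨u i | u i⟩ = c` for every one of them. -/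
def HasIndex (M : LeftModuleData A X) (r : X → X → A) (c : A) : Prop :=
  (∃ (k : ℕ) (u : Fin k → X), M.IsBasis u) ∧
    ∀ (k : ℕ) (u : Fin k → X), M.IsBasis u → ∑ i, r (u i) (u i) = c

/-- The left module `A ▷ x` generated by `x`. -/
def cyclic (M : LeftModuleData A X) (x : X) : Submodule ℂ X :=
  LinearMap.range (M.lsmul.toLinearMap.flip x)

theorem lsmul_mem_cyclic (M : LeftModuleData A X) (x : X) :
    ∀ (a : A), ∀ y ∈ M.cyclic x, M.lsmul a y ∈ M.cyclic x := by
  rintro a _ ⟨b, rfl⟩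
  exact ⟨a * b, by simp⟩

/-- Restriction to a subspace that is stable under the left action. -/
def restrict (M : LeftModuleData A X) (P : Submodule ℂ X)
    (hP : ∀ (a : A), ∀ y ∈ P, M.lsmul a y ∈ P) : LeftModuleData A P where
  lsmul := AlgHom.ofLinearMap
    { toFun := fun a => (M.lsmul a).restrict (hP a)
      map_add' := fun a b => by ext; simp
      map_smul' := fun c a => by ext; simp }
    (by ext; simp) (fun a b => by ext; simp)
  linner := LinearMap.mk₂'ₛₗ (RingHom.id ℂ) (starRingEnd ℂ) (fun x y => M.linner x y)
    (by simp) (by simp) (by simp) (by simp)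

/-- The direct sum of finitely many left modules, with the sum of the forms. -/
def directSum {ι : Type*} [Fintype ι] {X : ι → Type*} [∀ i, AddCommGroup (X i)]
    [∀ i, Module ℂ (X i)] (M : ∀ i, LeftModuleData A (X i)) :
    LeftModuleData A (∀ i, X i) where
  lsmul := AlgHom.ofLinearMap
    { toFun := fun a => LinearMap.pi fun i => (M i).lsmul a ∘ₗ LinearMap.proj i
      map_add' := fun a b => LinearMap.ext fun x => funext fun i => by simp
      map_smul' := fun c a => LinearMap.ext fun x => funext fun i => by simp }
    (LinearMap.ext fun x => funext fun i => by simp)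
    (fun a b => LinearMap.ext fun x => funext fun i => by simp)
  linner := LinearMap.mk₂'ₛₗ (RingHom.id ℂ) (starRingEnd ℂ)
    (fun x y => ∑ i, (M i).linner (x i) (y i))
    (by simp [Finset.sum_add_distrib]) (by simp [Finset.smul_sum])
    (by simp [Finset.sum_add_distrib]) (by simp [Finset.smul_sum])

/-- An isomorphism of left Hilbert modules: a left `A`-linear bijection that preserves the forms. -/
def IsUnitary (M : LeftModuleData A X) (N : LeftModuleData A Y) (U : X ≃ₗ[ℂ] Y) : Prop :=
  (∀ (a : A) (x : X), U (M.lsmul a x) = N.lsmul a (U x)) ∧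
    ∀ x y : X, N.linner (U x) (U y) = M.linner x y

end LeftModuleData

namespace RightModuleData

/-- A right Hilbert `A`-module. -/
structure IsHilbert (M : RightModuleData A X) : Prop where
  rinner_rsmul : ∀ (x y : X) (a : A), M.rinner x (M.rsmul (.op a) y) = M.rinner x y * a
  star_rinner : ∀ x y : X, star (M.rinner x y) = M.rinner y x
  rinner_nonneg : ∀ x : X, ∃ b : A, M.rinner x x = star b * b
  rinner_definite : ∀ x : X, M.rinner x x = 0 → x = 0
  complete : ∀ u : ℕ → X,
    (∀ ε > 0, ∃ N, ∀ p ≥ N, ∀ q ≥ N, ‖M.rinner (u p - u q) (u p - u q)‖ < ε) →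
      ∃ x : X, ∀ ε > 0, ∃ N, ∀ p ≥ N, ‖M.rinner (u p - x) (u p - x)‖ < ε

/-- A finite right Pimsner–Popa basis: `x = ∑ i, u i ◁ ⟨u i | x⟩` for all `x`. -/
def IsBasis (M : RightModuleData A X) {ι : Type*} [Fintype ι] (u : ι → X) : Prop :=
  ∀ x : X, ∑ i, M.rsmul (.op (M.rinner (u i) x)) (u i) = x

/-- Finitely generated projective right Hilbert modules. -/
def IsFgp (M : RightModuleData A X) : Prop :=
  M.IsHilbert ∧ ∃ (k : ℕ) (u : Fin k → X), M.IsBasis u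

/-- The right Watatani index, with respect to a left form `l`, is `c`: finite right Pimsner–Popa
bases `u` exist, and `∑ i, ⟨u i, u i⟩ = c` for every one of them. -/
def HasIndex (M : RightModuleData A X) (l : X → X → A) (c : A) : Prop :=
  (∃ (k : ℕ) (u : Fin k → X), M.IsBasis u) ∧
    ∀ (k : ℕ) (u : Fin k → X), M.IsBasis u → ∑ i, l (u i) (u i) = c

/-- Restriction to a subspace that is stable under the right action. -/
def restrict (M : RightModuleData A X) (P : Submodule ℂ X)
    (hP : ∀ (a : A), ∀ y ∈ P, M.rsmul (.op a) y ∈ P) : RightModuleData A P where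
  rsmul := AlgHom.ofLinearMap
    { toFun := fun a => (M.rsmul a).restrict (hP a.unop)
      map_add' := fun a b => by ext; simp; rfl
      map_smul' := fun c a => by ext; simp; rfl }
    (by ext; simp) (fun a b => by ext; simp; rfl)
  rinner := LinearMap.mk₂'ₛₗ (starRingEnd ℂ) (RingHom.id ℂ) (fun x y => M.rinner x y)
    (by simp) (by simp) (by simp) (by simp)

/-- The direct sum of finitely many right modules, with the sum of the forms. -/
def directSum {ι : Type*} [Fintype ι] {X : ι → Type*} [∀ i, AddCommGroup (X i)]
    [∀ i, Module ℂ (X i)] (M : ∀ i, RightModuleData A (X i)) :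
    RightModuleData A (∀ i, X i) where
  rsmul := AlgHom.ofLinearMap
    { toFun := fun a => LinearMap.pi fun i => (M i).rsmul a ∘ₗ LinearMap.proj i
      map_add' := fun a b => LinearMap.ext fun x => funext fun i => by simp
      map_smul' := fun c a => LinearMap.ext fun x => funext fun i => by simp }
    (LinearMap.ext fun x => funext fun i => by simp)
    (fun a b => LinearMap.ext fun x => funext fun i => by simp)
  rinner := LinearMap.mk₂'ₛₗ (starRingEnd ℂ) (RingHom.id ℂ)
    (fun x y => ∑ i, (M i).rinner (x i) (y i))
    (by simp [Finset.sum_add_distrib]) (by simp [Finset.smul_sum])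
    (by simp [Finset.sum_add_distrib]) (by simp [Finset.smul_sum])

/-- An isomorphism of right Hilbert modules. -/
def IsUnitary (M : RightModuleData A X) (N : RightModuleData A Y) (U : X ≃ₗ[ℂ] Y) : Prop :=
  (∀ (a : A) (x : X), U (M.rsmul (.op a) x) = N.rsmul (.op a) (U x)) ∧
    ∀ x y : X, N.rinner (U x) (U y) = M.rinner x y

end RightModuleData

namespace BimoduleData

/-- A finitely generated projective Hilbert `A`-`A` bimodule: both sides are finitely generated
projective Hilbert modules, the actions commute, each action is by operators that are adjointable
for the form of the other side, and the two norms are equivalent. -/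
structure IsFgp (M : BimoduleData A X) : Prop where
  left : M.toLeftModuleData.IsFgp
  right : M.toRightModuleData.IsFgp
  smul_comm : ∀ (a b : A) (x : X),
    M.lsmul a (M.rsmul (.op b) x) = M.rsmul (.op b) (M.lsmul a x)
  linner_rsmul : ∀ (x y : X) (a : A),
    M.linner (M.rsmul (.op a) x) y = M.linner x (M.rsmul (.op (star a)) y)
  rinner_lsmul : ∀ (a : A) (x y : X),
    M.rinner (M.lsmul a x) y = M.rinner x (M.lsmul (star a) y)
  left_le_right : ∃ C : ℝ, ∀ x : X, ‖M.linner x x‖ ≤ C * ‖M.rinner x x‖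
  right_le_left : ∃ C : ℝ, ∀ x : X, ‖M.rinner x x‖ ≤ C * ‖M.linner x x‖

/-- The `A`-`A` bimodular linear maps `X → X`. -/
def bimodEnd (M : BimoduleData A X) : Subalgebra ℂ (Module.End ℂ X) where
  carrier := {T | (∀ (a : A) (x : X), T (M.lsmul a x) = M.lsmul a (T x)) ∧
    ∀ (a : A) (x : X), T (M.rsmul (.op a) x) = M.rsmul (.op a) (T x)}
  mul_mem' := fun hS hT => ⟨fun a x => by simp [hS.1, hT.1], fun a x => by simp [hS.2, hT.2]⟩
  add_mem' := fun hS hT => ⟨fun a x => by simp [hS.1, hT.1], fun a x => by simp [hS.2, hT.2]⟩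
  algebraMap_mem' := fun c => ⟨fun a x => by simp, fun a x => by simp⟩

/-- `S` is an adjoint of `T` for the left form. -/
def IsLeftAdjoint (M : BimoduleData A X) (T S : Module.End ℂ X) : Prop :=
  ∀ x y : X, M.linner (T x) y = M.linner x (S y)

/-- `S` is an adjoint of `T` for the right form. -/
def IsRightAdjoint (M : BimoduleData A X) (T S : Module.End ℂ X) : Prop :=
  ∀ x y : X, M.rinner (T x) y = M.rinner x (S y)

/-- The algebra `End†(X)` of bimodular endomorphisms that are adjointable for both forms. -/
def endDag (M : BimoduleData A X) : Subalgebra ℂ (Module.End ℂ X) where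
  carrier := {T | T ∈ M.bimodEnd ∧ (∃ S, M.IsLeftAdjoint T S) ∧ ∃ S, M.IsRightAdjoint T S}
  mul_mem' := by
    rintro T T' ⟨h, ⟨S, hS⟩, ⟨R, hR⟩⟩ ⟨h', ⟨S', hS'⟩, ⟨R', hR'⟩⟩
    exact ⟨mul_mem h h', ⟨S' * S, fun x y => by simp [hS _ _, hS' _ _]⟩,
      ⟨R' * R, fun x y => by simp [hR _ _, hR' _ _]⟩⟩
  add_mem' := by
    rintro T T' ⟨h, ⟨S, hS⟩, ⟨R, hR⟩⟩ ⟨h', ⟨S', hS'⟩, ⟨R', hR'⟩⟩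
    exact ⟨add_mem h h', ⟨S + S', fun x y => by simp [hS _ _, hS' _ _]⟩,
      ⟨R + R', fun x y => by simp [hR _ _, hR' _ _]⟩⟩
  algebraMap_mem' := fun c => ⟨algebraMap_mem _ c,
    ⟨algebraMap ℂ _ (star c), fun x y => by simp⟩, ⟨algebraMap ℂ _ (star c), fun x y => by simp⟩⟩

/-- An irreducible bimodule: it is nonzero and `End†(X) = ℂ id`. -/
def IsIrreducible (M : BimoduleData A X) : Prop :=
  Nontrivial X ∧ M.endDag = ⊥

/-- The sub-bimodule generated algebraically (without closure) by `x`: the finite sums of elements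
`a ▷ x ◁ b`. -/
def generated (M : BimoduleData A X) (x : X) : Submodule ℂ X :=
  Submodule.span ℂ {y | ∃ a b : A, y = M.rsmul (.op b) (M.lsmul a x)}

/-- Restriction to a subspace that is stable under both actions. -/
def restrict (M : BimoduleData A X) (P : Submodule ℂ X)
    (hl : ∀ (a : A), ∀ y ∈ P, M.lsmul a y ∈ P)
    (hr : ∀ (a : A), ∀ y ∈ P, M.rsmul (.op a) y ∈ P) : BimoduleData A P where
  toLeftModuleData := M.toLeftModuleData.restrict P hl
  toRightModuleData := M.toRightModuleData.restrict P hr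

/-- The orthogonal direct sum of finitely many bimodules. -/
def directSum {ι : Type*} [Fintype ι] {X : ι → Type*} [∀ i, AddCommGroup (X i)]
    [∀ i, Module ℂ (X i)] (M : ∀ i, BimoduleData A (X i)) : BimoduleData A (∀ i, X i) where
  toLeftModuleData := LeftModuleData.directSum fun i => (M i).toLeftModuleData
  toRightModuleData := RightModuleData.directSum fun i => (M i).toRightModuleData

/-- An isomorphism of Hilbert bimodules: a bimodular bijection that preserves both forms. -/
def IsUnitary (M : BimoduleData A X) (N : BimoduleData A Y) (U : X ≃ₗ[ℂ] Y) : Prop :=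
  M.toLeftModuleData.IsUnitary N.toLeftModuleData U ∧
    M.toRightModuleData.IsUnitary N.toRightModuleData U

end BimoduleData

end General

/-! ## The Cuntz algebra, its gauge action and its core -/

/-- The Cuntz relations `s i⋆ s j = δ_{ij} 1` and `∑ i, s i s i⋆ = 1`. -/
structure IsCuntzFamily {n : ℕ} {B : Type*} [Ring B] [StarRing B] (s : Fin n → B) : Prop where
  star_mul : ∀ i j, star (s i) * s j = if i = j then 1 else 0
  sum_mul_star : ∑ i, s i * star (s i) = 1

/-- The algebra of bounded operators on the separable Hilbert space `ℓ²(ℕ)`. -/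
abbrev BoundedOp : Type := lp (fun _ : ℕ => ℂ) 2 →L[ℂ] lp (fun _ : ℕ => ℂ) 2

instance : Nontrivial (lp (fun _ : ℕ => ℂ) 2) :=
  ⟨lp.single 2 0 1, 0, fun h => by simpa using congrArg (fun f => f 0) h⟩

/-- All representations of the Cuntz relations on `ℓ²(ℕ)`. -/
def CuntzRep (n : ℕ) : Type := {t : Fin n → BoundedOp // IsCuntzFamily t}

/-- The C*-algebra of bounded families of operators, indexed by the representations of the Cuntz
relations on `ℓ²(ℕ)`. -/
abbrev CuntzAmbient (n : ℕ) : Type := lp (fun _ : CuntzRep n => BoundedOp) ∞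

instance (n : ℕ) : CStarAlgebra (CuntzAmbient n) where

theorem IsCuntzFamily.norm_le {n : ℕ} {t : Fin n → BoundedOp} (ht : IsCuntzFamily t) (i : Fin n) :
    ‖t i‖ ≤ 1 := by
  have h := CStarRing.norm_star_mul_self (x := t i)
  rw [ht.star_mul, if_pos rfl, norm_one] at h
  nlinarith [norm_nonneg (t i)]

/-- The generators in the universal representation: the `i`-th one is the family of all `t i`. -/
def universalGen (n : ℕ) (i : Fin n) : CuntzAmbient n :=
  ⟨fun t => t.1 i, memℓp_infty ⟨1, by rintro _ ⟨t, rfl⟩; exact t.2.norm_le i⟩⟩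

/-- The Cuntz algebra `𝒪_n`: the universal C*-algebra generated by elements `s i` with
`s i⋆ s j = δ_{ij} 1` and `∑ i, s i s i⋆ = 1`, constructed in its universal representation. Thus the
norm of a polynomial in the generators is the supremum of its norms over all representations of the
relations; representations on `ℓ²(ℕ)` suffice, as a C*-algebra generated by finitely many elements
is separable. -/
def cuntzSubalgebra (n : ℕ) : StarSubalgebra ℂ (CuntzAmbient n) :=
  (StarAlgebra.adjoin ℂ (Set.range (universalGen n))).topologicalClosure

instance (n : ℕ) : IsClosed (cuntzSubalgebra n : Set (CuntzAmbient n)) :=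
  StarSubalgebra.isClosed_topologicalClosure _

/-- The Cuntz algebra as a C*-algebra. -/
def CuntzAlgebra (n : ℕ) : Type := cuntzSubalgebra n

instance (n : ℕ) : CStarAlgebra (CuntzAlgebra n) :=
  inferInstanceAs (CStarAlgebra (cuntzSubalgebra n))

/-- The inclusion of the Cuntz algebra into the ambient C*-algebra. -/
def cuntzIncl (n : ℕ) : CuntzAlgebra n →⋆ₐ[ℂ] CuntzAmbient n := (cuntzSubalgebra n).subtype

theorem cuntzIncl_injective (n : ℕ) : Function.Injective (cuntzIncl n) := Subtype.val_injective

/-- Evaluation of a bounded family at a representation. -/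
def ambientEval {n : ℕ} (t : CuntzRep n) : CuntzAmbient n →⋆ₐ[ℂ] BoundedOp where
  toFun f := f t
  map_one' := rfl
  map_mul' _ _ := rfl
  map_zero' := rfl
  map_add' _ _ := rfl
  commutes' _ := rfl
  map_star' _ := rfl

theorem ambientEval_ext {n : ℕ} {f g : CuntzAmbient n} (h : ∀ t, ambientEval t f = ambientEval t g) :
    f = g :=
  lp.ext (funext h)

/-- The generating isometries `s i` of the Cuntz algebra. -/
def cuntzGen {n : ℕ} (i : Fin n) : CuntzAlgebra n :=
  ⟨universalGen n i, StarSubalgebra.le_topologicalClosure _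
    (StarAlgebra.subset_adjoin ℂ _ ⟨i, rfl⟩)⟩

theorem ambientEval_cuntzGen {n : ℕ} (t : CuntzRep n) (i : Fin n) :
    ambientEval t (cuntzIncl n (cuntzGen i)) = t.1 i := rfl

theorem isCuntzFamily_cuntzGen (n : ℕ) : IsCuntzFamily (cuntzGen (n := n)) where
  star_mul i j := by
    refine cuntzIncl_injective n (ambientEval_ext fun t => ?_)
    rw [map_mul, map_mul, map_star, map_star, ambientEval_cuntzGen, ambientEval_cuntzGen,
      t.2.star_mul]
    split_ifs <;> simp
  sum_mul_star := by
    refine cuntzIncl_injective n (ambientEval_ext fun t => ?_)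
    simp only [map_sum, map_mul, map_star, ambientEval_cuntzGen, t.2.sum_mul_star, map_one]

theorem circle_star_mul (z : Circle) : star (z : ℂ) * (z : ℂ) = 1 := by
  rw [Complex.star_def, Complex.conj_mul', Circle.norm_coe]
  norm_num

/-- The representation `(z t i)_i` for a representation `(t i)_i` and `z` in the circle. -/
def CuntzRep.rotate {n : ℕ} (z : Circle) (t : CuntzRep n) : CuntzRep n :=
  ⟨fun i => (z : ℂ) • t.1 i, by
    have hz' : (z : ℂ) * star (z : ℂ) = 1 := by rw [mul_comm, circle_star_mul]
    constructor
    · intro i j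
      simp only [star_smul, smul_mul_smul_comm, t.2.star_mul, circle_star_mul, one_smul]
    · simp only [star_smul, smul_mul_smul_comm, hz', one_smul, t.2.sum_mul_star]⟩

/-- Reindexing of bounded families along `t ↦ z t`. -/
def ambientGauge {n : ℕ} (z : Circle) : CuntzAmbient n →⋆ₐ[ℂ] CuntzAmbient n where
  toFun f := ⟨fun t => f (t.rotate z), memℓp_infty ⟨‖f‖, by
    rintro _ ⟨t, rfl⟩; exact lp.norm_apply_le_norm ENNReal.top_ne_zero f _⟩⟩
  map_one' := rfl
  map_mul' _ _ := rfl
  map_zero' := rfl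
  map_add' _ _ := rfl
  commutes' _ := rfl
  map_star' _ := rfl

theorem ambientGauge_gen {n : ℕ} (z : Circle) (i : Fin n) :
    ambientGauge z (universalGen n i) = (z : ℂ) • universalGen n i := rfl

theorem ambientGauge_mem {n : ℕ} (z : Circle) (x : CuntzAmbient n) (hx : x ∈ cuntzSubalgebra n) :
    ambientGauge z x ∈ cuntzSubalgebra n := by
  have h1 : (StarAlgebra.adjoin ℂ (Set.range (universalGen n))) ≤
      (cuntzSubalgebra n).comap (ambientGauge z) := by
    refine StarAlgebra.adjoin_le ?_
    rintro _ ⟨i, rfl⟩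
    change ambientGauge z (universalGen n i) ∈ cuntzSubalgebra n
    rw [ambientGauge_gen]
    exact (cuntzSubalgebra n).smul_mem (cuntzGen i).2 _
  have hc : Continuous (ambientGauge (n := n) z) :=
    AddMonoidHomClass.continuous_of_bound _ 1
      fun y => by simpa using NonUnitalStarAlgHom.norm_apply_le (ambientGauge z) y
  exact StarSubalgebra.topologicalClosure_minimal h1
    ((StarSubalgebra.isClosed_topologicalClosure _).preimage hc) hx

/-- The gauge action of the circle on the Cuntz algebra. -/
def cuntzGauge {n : ℕ} (z : Circle) : CuntzAlgebra n →⋆ₐ[ℂ] CuntzAlgebra n :=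
  ((ambientGauge z).comp (cuntzIncl n)).codRestrict (cuntzSubalgebra n)
    fun x => ambientGauge_mem z _ x.2

/-- The gauge action is given on the generators by `s i ↦ z s i`. -/
theorem cuntzGauge_gen {n : ℕ} (z : Circle) (i : Fin n) :
    cuntzGauge z (cuntzGen i) = (z : ℂ) • cuntzGen i := rfl

/-- The core of the Cuntz algebra: the fixed points of the gauge action. -/
def coreSubalgebra (n : ℕ) : StarSubalgebra ℂ (CuntzAlgebra n) where
  carrier := {x | ∀ z : Circle, cuntzGauge z x = x}
  mul_mem' hx hy z := by rw [map_mul, hx z, hy z]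
  add_mem' hx hy z := by rw [map_add, hx z, hy z]
  algebraMap_mem' c z := AlgHomClass.commutes (cuntzGauge z) c
  star_mem' hx z := by rw [map_star, hx z]

instance (n : ℕ) : IsClosed (coreSubalgebra n : Set (CuntzAlgebra n)) := by
  have : (coreSubalgebra n : Set (CuntzAlgebra n)) = ⋂ z : Circle, {x | cuntzGauge z x = x} := by
    ext x
    simp only [Set.mem_iInter]
    rfl
  rw [this]
  exact isClosed_iInter fun z => isClosed_eq
    (AddMonoidHomClass.continuous_of_bound (cuntzGauge z) 1
      fun y => by simpa using NonUnitalStarAlgHom.norm_apply_le (cuntzGauge z) y) continuous_id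

/-- The core `A` of the Cuntz algebra as a C*-algebra. -/
def Core (n : ℕ) : Type := coreSubalgebra n

instance (n : ℕ) : CStarAlgebra (Core n) :=
  inferInstanceAs (CStarAlgebra (coreSubalgebra n))

/-- The inclusion of the core into the Cuntz algebra. -/
def coreIncl (n : ℕ) : Core n →⋆ₐ[ℂ] CuntzAlgebra n := (coreSubalgebra n).subtype

theorem coreIncl_injective (n : ℕ) : Function.Injective (coreIncl n) := Subtype.val_injective

section Core

variable {n : ℕ}

/-- An element of the Cuntz algebra that is fixed by the gauge action, as an element of the core. -/
def Core.mk (x : CuntzAlgebra n) (hx : ∀ z : Circle, cuntzGauge z x = x) : Core n := ⟨x, hx⟩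

theorem coreIncl_mk (x : CuntzAlgebra n) (hx : ∀ z : Circle, cuntzGauge z x = x) :
    coreIncl n (Core.mk x hx) = x := rfl

theorem cuntzGauge_coreIncl (z : Circle) (a : Core n) :
    cuntzGauge z (coreIncl n a) = coreIncl n a := a.2 z

theorem mul_star_mem_core (i j : Fin n) (a : Core n) (z : Circle) :
    cuntzGauge z (cuntzGen i * coreIncl n a * star (cuntzGen j)) =
      cuntzGen i * coreIncl n a * star (cuntzGen j) := by
  rw [map_mul, map_mul, map_star, cuntzGauge_gen, cuntzGauge_gen, cuntzGauge_coreIncl, star_smul,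
    smul_mul_assoc, mul_smul_comm, smul_mul_assoc, smul_smul, circle_star_mul, one_smul]

theorem star_mul_mem_core (i j : Fin n) (a : Core n) (z : Circle) :
    cuntzGauge z (star (cuntzGen i) * coreIncl n a * cuntzGen j) =
      star (cuntzGen i) * coreIncl n a * cuntzGen j := by
  rw [map_mul, map_mul, map_star, cuntzGauge_gen, cuntzGauge_gen, cuntzGauge_coreIncl, star_smul,
    smul_mul_assoc, mul_smul_comm, smul_mul_assoc, smul_smul, mul_comm, circle_star_mul, one_smul]

/-- The elements `s i s j⋆` of the core. -/
def unitE (i j : Fin n) : Core n :=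
  Core.mk (cuntzGen i * star (cuntzGen j)) (by simpa using mul_star_mem_core i j 1)

/-- The map `a ↦ s i a s i⋆`. -/
def conjGen (i : Fin n) : Core n →ₗ[ℂ] Core n where
  toFun a := Core.mk (cuntzGen i * coreIncl n a * star (cuntzGen i)) (mul_star_mem_core i i a)
  map_add' a b := coreIncl_injective n (by simp [coreIncl_mk, mul_add, add_mul])
  map_smul' c a := coreIncl_injective n (by simp [coreIncl_mk])

/-- The map `a ↦ s i⋆ a s i`. -/
def compressGen (i : Fin n) : Core n →ₗ[ℂ] Core n where
  toFun a := Core.mk (star (cuntzGen i) * coreIncl n a * cuntzGen i) (star_mul_mem_core i i a)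
  map_add' a b := coreIncl_injective n (by simp [coreIncl_mk, mul_add, add_mul])
  map_smul' c a := coreIncl_injective n (by simp [coreIncl_mk])

theorem coreIncl_conjGen (i : Fin n) (a : Core n) :
    coreIncl n (conjGen i a) = cuntzGen i * coreIncl n a * star (cuntzGen i) := rfl

theorem coreIncl_unitE (i j : Fin n) :
    coreIncl n (unitE i j) = cuntzGen i * star (cuntzGen j) := rfl

theorem conjGen_mul (i j : Fin n) (a b : Core n) :
    conjGen i a * conjGen j b = if i = j then conjGen i (a * b) else 0 := by
  apply coreIncl_injective n
  have h : coreIncl n (conjGen i a * conjGen j b) = cuntzGen i * coreIncl n a *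
      ((star (cuntzGen i) * cuntzGen j) * (coreIncl n b * star (cuntzGen j))) := by
    simp only [map_mul, coreIncl_conjGen, mul_assoc]
  rw [h, (isCuntzFamily_cuntzGen n).star_mul]
  split_ifs with hij
  · subst hij
    simp only [coreIncl_conjGen, map_mul, mul_assoc, one_mul]
  · simp

/-- The canonical endomorphism `λ(a) = ∑ i, s i a s i⋆` of the core. -/
def coreLambda (n : ℕ) : Core n →⋆ₐ[ℂ] Core n :=
  have h1 : ∑ i, conjGen i (1 : Core n) = 1 := coreIncl_injective n (by
    simp only [map_sum, coreIncl_conjGen, map_one, mul_one,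
      (isCuntzFamily_cuntzGen n).sum_mul_star])
  { toFun := fun a => ∑ i, conjGen i a
    map_one' := h1
    map_mul' := fun a b => by
      simp [Finset.sum_mul_sum, conjGen_mul]
    map_zero' := by simp
    map_add' := fun a b => by simp [Finset.sum_add_distrib]
    commutes' := fun c => by
      simp only [Algebra.algebraMap_eq_smul_one, map_smul, ← Finset.smul_sum, h1]
    map_star' := fun a => coreIncl_injective n (by
      simp only [map_sum, map_star, star_sum, coreIncl_conjGen, star_mul, star_star, mul_assoc]) }

/-- The conditional expectation `ℰ(a) = ∑ i, s i s i⋆ a s i s i⋆`. -/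
def coreExpectation (n : ℕ) : Core n →ₗ[ℂ] Core n :=
  ∑ i, conjGen i ∘ₗ compressGen i

/-- The transfer operator `ℒ(a) = ∑ i, s i⋆ a s i`. -/
def coreTransfer (n : ℕ) : Core n →ₗ[ℂ] Core n :=
  ∑ i, compressGen i

/-- The bimodule `λA`: the space `A` with left action `a ▷ x = λ(a) x`, right action `x ◁ a = x a`,
left form `ℒ(ℰ(x y⋆))` and right form `x⋆ y`. -/
def lambdaBimodule (n : ℕ) : BimoduleData (Core n) (Core n) where
  lsmul := (Algebra.lmul ℂ (Core n)).comp (coreLambda n).toAlgHom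
  rsmul := AlgHom.ofLinearMap
    ((LinearMap.mul ℂ (Core n)).flip ∘ₗ (MulOpposite.opLinearEquiv ℂ).symm.toLinearMap)
    (by ext; simp) (fun a b => by ext; simp [mul_assoc])
  linner := LinearMap.mk₂'ₛₗ (RingHom.id ℂ) (starRingEnd ℂ)
    (fun x y => coreTransfer n (coreExpectation n (x * star y)))
    (by simp [add_mul]) (by simp) (by simp [mul_add]) (by simp)
  rinner := LinearMap.mk₂'ₛₗ (starRingEnd ℂ) (RingHom.id ℂ) (fun x y => star x * y)
    (by simp [add_mul]) (by simp) (by simp [mul_add]) (by simp)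

theorem lambdaBimodule_lsmul (a x : Core n) :
    (lambdaBimodule n).lsmul a x = coreLambda n a * x := rfl

theorem lambdaBimodule_rsmul (a x : Core n) :
    (lambdaBimodule n).rsmul (.op a) x = x * a := rfl

/-- The subspace `(s i s i⋆) A`. -/
def corner (i : Fin n) : Submodule ℂ (Core n) :=
  LinearMap.range (LinearMap.mulLeft ℂ (unitE i i))

theorem coreLambda_mul_unitE (i : Fin n) (a : Core n) :
    coreLambda n a * unitE i i = unitE i i * coreLambda n a := by
  have h : unitE i i = conjGen i (1 : Core n) := coreIncl_injective n (by
    rw [coreIncl_conjGen, coreIncl_unitE, map_one, mul_one])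
  change (∑ j, conjGen j a) * _ = _ * ∑ j, conjGen j a
  simp [h, Finset.sum_mul, Finset.mul_sum, conjGen_mul]

theorem lsmul_mem_corner (i : Fin n) (a : Core n) :
    ∀ x ∈ corner i, (lambdaBimodule n).lsmul a x ∈ corner i := by
  rintro _ ⟨y, rfl⟩
  refine ⟨coreLambda n a * y, ?_⟩
  rw [lambdaBimodule_lsmul, LinearMap.mulLeft_apply, LinearMap.mulLeft_apply, ← mul_assoc,
    ← mul_assoc, coreLambda_mul_unitE]

theorem rsmul_mem_corner (i : Fin n) (a : Core n) :
    ∀ x ∈ corner i, (lambdaBimodule n).rsmul (.op a) x ∈ corner i := by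
  rintro _ ⟨y, rfl⟩
  exact ⟨y * a, by simp [lambdaBimodule_rsmul, mul_assoc]⟩

/-- The sub-bimodule `(s i s i⋆) A` of `λA`. -/
def cornerBimodule (i : Fin n) : BimoduleData (Core n) (corner i) :=
  (lambdaBimodule n).restrict (corner i) (lsmul_mem_corner i) (rsmul_mem_corner i)

/-- The left module `A ▷ x` inside `λA`, with the restriction of the left form. -/
def blockModule (x : Core n) : LeftModuleData (Core n) ((lambdaBimodule n).cyclic x) :=
  (lambdaBimodule n).toLeftModuleData.restrict _
    ((lambdaBimodule n).toLeftModuleData.lsmul_mem_cyclic x)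

/-- The relative commutant `λ[A]' ∩ A`. -/
def relCommutant (n : ℕ) : StarSubalgebra ℂ (Core n) :=
  StarSubalgebra.centralizer ℂ (Set.range (coreLambda n))

end Core

end

/-!
The structure theory of the bimodule `λA` rests on one analytic fact: the core `A` is algebraically
simple with trivial centre.

*Simplicity* (`exists_sum_mul_mul_eq_one`). Averaging a noncommutative polynomial in the `s i` over
sufficiently many roots of unity kills its components of nonzero degree, so the increasing matrix
algebras spanned by `s_μ s_ν⋆` with `|μ| = |ν| = k` are dense in `A` (`exists_levelSpan_norm_sub_lt`).
An element `x` of such a matrix algebra has contractions `S`, `T` in the span of the `s_μ` with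
`S⋆ x T` a scalar of absolute value close to `‖x‖` (`IsCuntzSystem.exists_compress_eq_smul_one`;
the `*`-homomorphism from the matrices is contractive, and a matrix nearly attains its operator norm
on a pair of unit vectors). If `x` is close to a given `b ≠ 0`, the compression `S⋆ b T` is near that
scalar, hence invertible with inverse `y` in `A`, and `∑ μ, (s_μ y S⋆) b (T s_μ⋆) = 1` exhibits `1`
in the ideal generated by `b`. A central element minus a point of its spectrum then generates a
proper ideal, so it vanishes (`exists_eq_smul_one_of_central`). That `A ≠ 0` follows from a
representation of the Cuntz relations on `ℓ²(ℕ)` by shifts along a bijection `{1, …, n} × ℕ ≃ ℕ`.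

*The bimodule.* The elements `s i s j⋆` are matrix units that commute with `λ(A)`, and every `a` in `A`
is `∑ λ(a i j) s i s j⋆` with entries `a i j = s i⋆ a s j` (`sum_lambda_coreEntry_mul_unitE`). Since
`ℒ ∘ ℰ = ℒ`, the left form is `∑ k, s k⋆ x y⋆ s k`, and pairing `x` with `s i s j⋆` returns the entry
`x i j`; this makes the matrix units an orthonormal left basis, and all bases of the blocks and
corners are read off from it. The indices do not depend on the basis because each action is
adjointable for the form of the other side (`LeftModuleData.IsBasis.hasIndex`,
`RightModuleData.IsBasis.hasIndex`).

*Endomorphisms.* A bimodular endomorphism of `λA` is left multiplication by its value at `1`, which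
commutes with `λ(A)`. The entries of such an element are central in `A`, hence scalars, so that
`λ(A)' ∩ A` is the span of the matrix units; the same argument in a corner gives irreducibility.
-/

/-! ### Cuntz families on `ℓ²(ℕ)` -/

section Existence

/-- The standard orthonormal basis of `ℓ²(ℕ)`. -/
noncomputable def ellTwoBasis (k : ℕ) : lp (fun _ : ℕ => ℂ) 2 := lp.single 2 k 1

theorem inner_ellTwoBasis_left (k : ℕ) (f : lp (fun _ : ℕ => ℂ) 2) :
    inner ℂ (ellTwoBasis k) f = f k := by
  simp [ellTwoBasis, lp.inner_single_left]

theorem inner_ellTwoBasis (k l : ℕ) :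
    inner ℂ (ellTwoBasis k) (ellTwoBasis l) = if k = l then (1 : ℂ) else 0 := by
  rw [inner_ellTwoBasis_left, ellTwoBasis, lp.single_apply]
  by_cases h : k = l
  · subst h; simp
  · simp [h]

theorem BoundedOp.ext_basis {S T : BoundedOp} (h : ∀ k, S (ellTwoBasis k) = T (ellTwoBasis k)) :
    S = T := by
  ext1 f
  have hf := lp.hasSum_single (by norm_num : (2 : ℝ≥0∞) ≠ ⊤) f
  have hk : ∀ k, lp.single (E := fun _ : ℕ => ℂ) 2 k (f k) = f k • ellTwoBasis k := fun k => by
    rw [ellTwoBasis, ← lp.single_smul, smul_eq_mul, mul_one]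
  simp only [hk] at hf
  have h1 := S.hasSum hf
  have h2 := T.hasSum hf
  simp only [map_smul, h] at h1 h2
  exact h1.unique h2

theorem orthonormal_ellTwoBasis_comp {g : ℕ → ℕ} (hg : Function.Injective g) :
    Orthonormal ℂ fun k => ellTwoBasis (g k) := by
  rw [orthonormal_iff_ite]
  intro i j
  simp [inner_ellTwoBasis, hg.eq_iff]

/-- The isometry of `ℓ²(ℕ)` that maps the basis vector `k` to the basis vector `g k`. -/
noncomputable def basisShift {g : ℕ → ℕ} (hg : Function.Injective g) : BoundedOp :=
  (orthonormal_ellTwoBasis_comp hg).orthogonalFamily.linearIsometry.toContinuousLinearMap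

theorem basisShift_apply {g : ℕ → ℕ} (hg : Function.Injective g) (k : ℕ) :
    basisShift hg (ellTwoBasis k) = ellTwoBasis (g k) := by
  have h := (orthonormal_ellTwoBasis_comp hg).orthogonalFamily.linearIsometry_apply_single
    (i := k) (1 : ℂ)
  exact h.trans (one_smul ℂ _)

theorem star_basisShift_apply_coe {g : ℕ → ℕ} (hg : Function.Injective g) (k l : ℕ) :
    (star (basisShift hg) (ellTwoBasis k)) l = if g l = k then (1 : ℂ) else 0 := by
  rw [← inner_ellTwoBasis_left, ContinuousLinearMap.star_eq_adjoint,
    ContinuousLinearMap.adjoint_inner_right, basisShift_apply, inner_ellTwoBasis]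

variable {n : ℕ} (e : Fin n × ℕ ≃ ℕ)

theorem injective_comp_mk (i : Fin n) : Function.Injective fun k => e (i, k) := fun a b h => by
  simpa using h

theorem star_basisShift_apply (i j : Fin n) (k : ℕ) :
    star (basisShift (injective_comp_mk e i)) (ellTwoBasis (e (j, k))) =
      if i = j then ellTwoBasis k else 0 := by
  ext l
  rw [star_basisShift_apply_coe]
  by_cases h : i = j
  · simp [h, ← inner_ellTwoBasis_left, inner_ellTwoBasis]
  · simp [h]

/-- A bijection of `{1, …, n} × ℕ` with `ℕ` gives isometries of `ℓ²(ℕ)` whose ranges decompose the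
space, i.e. a representation of the Cuntz relations. -/
theorem isCuntzFamily_basisShift :
    IsCuntzFamily fun i : Fin n => basisShift (injective_comp_mk e i) where
  star_mul i j := by
    refine BoundedOp.ext_basis fun k => ?_
    rw [mul_apply_eq_comp, basisShift_apply, star_basisShift_apply]
    split_ifs <;> simp
  sum_mul_star := by
    refine BoundedOp.ext_basis fun k => ?_
    obtain ⟨⟨j, l⟩, rfl⟩ := e.surjective k
    rw [sum_apply, Finset.sum_eq_single j]
    · rw [mul_apply_eq_comp, star_basisShift_apply, if_pos rfl, basisShift_apply]
      simp
    · intro i _ hij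
      rw [mul_apply_eq_comp, star_basisShift_apply, if_neg hij, map_zero]
    · simp

end Existence

theorem core_nontrivial {n : ℕ} (hn : n ≠ 0) : Nontrivial (Core n) := by
  have : NeZero n := ⟨hn⟩
  obtain ⟨e⟩ : Nonempty (Fin n × ℕ ≃ ℕ) := nonempty_equiv_of_countable
  let t : CuntzRep n := ⟨_, isCuntzFamily_basisShift e⟩
  refine ⟨⟨0, 1, fun h => ?_⟩⟩
  have := congrArg (fun a => ambientEval t (cuntzIncl n (coreIncl n a))) h
  simp at this

/-! ### Matrix units from a finite Cuntz system -/

section CuntzSystem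

/-- The Cuntz relations for a family indexed by an arbitrary finite type. -/
structure IsCuntzSystem {ι B : Type*} [Fintype ι] [DecidableEq ι] [Ring B] [StarRing B]
    (u : ι → B) : Prop where
  star_mul : ∀ i j, star (u i) * u j = if i = j then 1 else 0
  sum_mul_star : ∑ i, u i * star (u i) = 1

variable {ι B : Type*} [Fintype ι] [DecidableEq ι] [CStarAlgebra B] {u : ι → B}

namespace IsCuntzSystem

theorem star_mul_self (hu : IsCuntzSystem u) (i : ι) : star (u i) * u i = 1 := by
  rw [hu.star_mul, if_pos rfl]

theorem star_mul_mul (hu : IsCuntzSystem u) (i j : ι) (x : B) :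
    star (u i) * (u j * x) = if i = j then x else 0 := by
  rw [← mul_assoc, hu.star_mul]; split_ifs <;> simp

theorem sum_mul_star_mul (hu : IsCuntzSystem u) (x : B) : ∑ i, u i * (star (u i) * x) = x := by
  simp only [← mul_assoc, ← Finset.sum_mul, hu.sum_mul_star, one_mul]

theorem sum_sum_compress (hu : IsCuntzSystem u) (x : B) :
    ∑ i, ∑ j, u i * (star (u i) * x * u j) * star (u j) = x := by
  calc ∑ i, ∑ j, u i * (star (u i) * x * u j) * star (u j)
      = (∑ i, u i * star (u i)) * x * ∑ j, u j * star (u j) := by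
        rw [Finset.sum_comm]
        simp only [Finset.sum_mul, Finset.mul_sum, mul_assoc]
    _ = x := by rw [hu.sum_mul_star, one_mul, mul_one]

theorem ext_compress (hu : IsCuntzSystem u) {x y : B}
    (h : ∀ i j, star (u i) * x * u j = star (u i) * y * u j) : x = y := by
  rw [← hu.sum_sum_compress x, ← hu.sum_sum_compress y]
  simp only [h]

theorem compress_sum (hu : IsCuntzSystem u) (M : Matrix ι ι ℂ) (k l : ι) :
    star (u k) * (∑ i, ∑ j, M i j • (u i * star (u j))) * u l = M k l • 1 := by
  simp [Finset.mul_sum, Finset.sum_mul, hu.star_mul, hu.star_mul_mul]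

/-- The `*`-homomorphism `M ↦ ∑ i j, M i j u i u j⋆`, which maps the matrix units to the elements
`u i u j⋆`. -/
def matrixHom (hu : IsCuntzSystem u) : Matrix ι ι ℂ →⋆ₐ[ℂ] B where
  toFun M := ∑ i, ∑ j, M i j • (u i * star (u j))
  map_one' := hu.ext_compress fun i j => by
    rw [hu.compress_sum, mul_one, hu.star_mul, Matrix.one_apply]
    split_ifs <;> simp
  map_mul' M N := hu.ext_compress fun k l => by
    -- insert `∑ i, u i u i⋆ = 1` between the two factors
    have h : ∀ x y : B, star (u k) * (x * y) * u l =
        ∑ i, (star (u k) * x * u i) * (star (u i) * y * u l) := fun x y => by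
      calc star (u k) * (x * y) * u l
          = star (u k) * x * (∑ i, u i * star (u i)) * y * u l := by
            rw [hu.sum_mul_star, mul_one]; simp only [mul_assoc]
        _ = _ := by simp only [Finset.sum_mul, Finset.mul_sum, mul_assoc]
    rw [h, hu.compress_sum]
    simp only [hu.compress_sum, smul_mul_smul_comm, mul_one, ← Finset.sum_smul, Matrix.mul_apply]
  map_zero' := by simp
  map_add' M N := by simp [add_smul, Finset.sum_add_distrib]
  commutes' c := hu.ext_compress fun i j => by
    rw [hu.compress_sum, Algebra.algebraMap_eq_smul_one, Algebra.algebraMap_eq_smul_one,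
      mul_smul_comm, smul_mul_assoc, mul_one, hu.star_mul, Matrix.smul_apply, Matrix.one_apply]
    split_ifs <;> simp
  map_star' M := by
    simp only [star_sum, star_smul, StarMul.star_mul, star_star, Matrix.star_apply]
    rw [Finset.sum_comm]

theorem matrixHom_apply (hu : IsCuntzSystem u) (M : Matrix ι ι ℂ) :
    hu.matrixHom M = ∑ i, ∑ j, M i j • (u i * star (u j)) := rfl

theorem compress_matrixHom (hu : IsCuntzSystem u) (M : Matrix ι ι ℂ) (k l : ι) :
    star (u k) * hu.matrixHom M * u l = M k l • 1 := hu.compress_sum M k l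

theorem matrixHom_single (hu : IsCuntzSystem u) (k l : ι) :
    hu.matrixHom (Matrix.single k l 1) = u k * star (u l) := by
  refine hu.ext_compress fun i j => ?_
  rw [hu.compress_matrixHom, mul_assoc, mul_assoc, hu.star_mul, hu.star_mul_mul,
    Matrix.single_apply]
  by_cases h1 : k = i <;> by_cases h2 : l = j <;> simp [h1, h2, eq_comm]

open scoped Matrix.Norms.L2Operator in
theorem norm_matrixHom_le (hu : IsCuntzSystem u) (M : Matrix ι ι ℂ) :
    ‖hu.matrixHom M‖ ≤ ‖Matrix.toEuclideanCLM (n := ι) (𝕜 := ℂ) M‖ :=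
  (NonUnitalStarAlgHom.norm_apply_le hu.matrixHom M).trans_eq (Matrix.cstar_norm_def M)

/-- The combination `∑ i, v i u i` of the isometries `u i`. -/
def comb (u : ι → B) (v : EuclideanSpace ℂ ι) : B := ∑ i, v i • u i

theorem star_comb_mul_comb (hu : IsCuntzSystem u) (v w : EuclideanSpace ℂ ι) :
    star (comb u v) * comb u w = inner ℂ v w • (1 : B) := by
  simp [comb, star_sum, Finset.sum_mul, Finset.mul_sum, hu.star_mul, PiLp.inner_apply,
    Finset.sum_smul, smul_smul]

theorem norm_comb_le (hu : IsCuntzSystem u) [Nontrivial B] (v : EuclideanSpace ℂ ι) :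
    ‖comb u v‖ ≤ ‖v‖ := by
  have h := CStarRing.norm_star_mul_self (x := comb u v)
  rw [hu.star_comb_mul_comb, norm_smul, norm_one, mul_one, inner_self_eq_norm_sq_to_K] at h
  simp only [norm_pow, RCLike.norm_ofReal, abs_norm] at h
  nlinarith [norm_nonneg v, norm_nonneg (comb u v)]

theorem matrixHom_mul_comb (hu : IsCuntzSystem u) (M : Matrix ι ι ℂ) (w : EuclideanSpace ℂ ι) :
    hu.matrixHom M * comb u w = comb u (Matrix.toEuclideanCLM (n := ι) (𝕜 := ℂ) M w) := by
  simp [comb, matrixHom_apply, Finset.mul_sum, Finset.sum_mul, mul_assoc, hu.star_mul,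
    Matrix.mulVec, dotProduct, Finset.sum_smul, Finset.smul_sum, smul_smul]
  rw [Finset.sum_comm]
  simp only [mul_comm]

/-- The norm of a combination `x` of the matrix units is attained, up to any error, by a scalar
compression `S⋆ x T` with contractions `S`, `T` in the span of the `u i`. -/
theorem exists_compress_eq_smul_one (hu : IsCuntzSystem u) [Nontrivial B] (M : Matrix ι ι ℂ)
    {r : ℝ} (hr : 0 ≤ r) (h : r < ‖hu.matrixHom M‖) :
    ∃ (v w : EuclideanSpace ℂ ι) (t : ℂ), ‖comb u v‖ ≤ 1 ∧ ‖comb u w‖ ≤ 1 ∧ r < ‖t‖ ∧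
      star (comb u v) * hu.matrixHom M * comb u w = t • 1 := by
  obtain ⟨w, hw, hrw⟩ :=
    ContinuousLinearMap.exists_lt_apply_of_lt_opNorm _ (h.trans_le (hu.norm_matrixHom_le M))
  set y := Matrix.toEuclideanCLM (n := ι) (𝕜 := ℂ) M w with hy
  have hy0 : ‖y‖ ≠ 0 := (hr.trans_lt hrw).ne'
  refine ⟨(‖y‖ : ℂ)⁻¹ • y, w, inner ℂ ((‖y‖ : ℂ)⁻¹ • y) y, (hu.norm_comb_le _).trans ?_,
    (hu.norm_comb_le _).trans hw.le, ?_, ?_⟩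
  · rw [norm_smul, norm_inv, Complex.norm_real, norm_norm, inv_mul_cancel₀ hy0]
  · rw [inner_smul_left, inner_self_eq_norm_sq_to_K, norm_mul, norm_pow, RCLike.norm_conj, norm_inv]
    simp only [Complex.norm_real, RCLike.norm_ofReal, abs_norm, norm_norm]
    rwa [pow_two, inv_mul_cancel_left₀ hy0]
  · rw [mul_assoc, hu.matrixHom_mul_comb, hu.star_comb_mul_comb, hy]

end IsCuntzSystem

end CuntzSystem

/-! ### Words in the generators -/

section Words

variable {n : ℕ}

theorem isCuntzSystem_cuntzGen (n : ℕ) : IsCuntzSystem (cuntzGen (n := n)) :=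
  ⟨(isCuntzFamily_cuntzGen n).star_mul, (isCuntzFamily_cuntzGen n).sum_mul_star⟩

/-- The product of the generators along a word. -/
noncomputable def cuntzWord (l : List (Fin n)) : CuntzAlgebra n := (l.map cuntzGen).prod

theorem cuntzWord_nil : cuntzWord ([] : List (Fin n)) = 1 := rfl

theorem cuntzWord_cons (i : Fin n) (l : List (Fin n)) :
    cuntzWord (i :: l) = cuntzGen i * cuntzWord l := by
  simp [cuntzWord]

theorem cuntzWord_append (l m : List (Fin n)) :
    cuntzWord (l ++ m) = cuntzWord l * cuntzWord m := by
  simp [cuntzWord]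

theorem cuntzGauge_word (z : Circle) (l : List (Fin n)) :
    cuntzGauge z (cuntzWord l) = (z : ℂ) ^ l.length • cuntzWord l := by
  induction l with
  | nil => simp [cuntzWord_nil]
  | cons i l ih =>
    rw [cuntzWord_cons, map_mul, ih, cuntzGauge_gen, smul_mul_smul_comm, List.length_cons,
      pow_succ']

/-- The words of a fixed length satisfy the Cuntz relations. -/
theorem isCuntzSystem_word (n k : ℕ) :
    IsCuntzSystem fun μ : Fin k → Fin n => cuntzWord (List.ofFn μ) := by
  induction k with
  | zero =>
    constructor
    · intro i j
      simp [cuntzWord_nil, Subsingleton.elim i j]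
    · simp [cuntzWord_nil]
  | succ k ih =>
    constructor
    · intro μ ν
      simp only [List.ofFn_succ, cuntzWord_cons, star_mul, mul_assoc,
        (isCuntzSystem_cuntzGen n).star_mul_mul]
      have hμν : μ = ν ↔ μ 0 = ν 0 ∧ (fun i => μ (Fin.succ i)) = fun i => ν (Fin.succ i) := by
        simp only [funext_iff]
        exact Fin.forall_fin_succ
      by_cases h : μ 0 = ν 0
      · simp [h, ih.star_mul, hμν]
      · simp [h, hμν]
    · rw [← (Fin.consEquiv fun _ : Fin (k + 1) => Fin n).sum_comp, Fintype.sum_prod_type]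
      simp only [Fin.consEquiv_apply, List.ofFn_succ, Fin.cons_zero, Fin.cons_succ,
        cuntzWord_cons, star_mul]
      have h : ∀ (i : Fin n) (μ : Fin k → Fin n),
          cuntzGen i * cuntzWord (List.ofFn μ) * (star (cuntzWord (List.ofFn μ)) *
            star (cuntzGen i)) = cuntzGen i * (cuntzWord (List.ofFn μ) *
              star (cuntzWord (List.ofFn μ))) * star (cuntzGen i) := fun i μ => by
        simp only [mul_assoc]
      simp only [h, ← Finset.sum_mul, ← Finset.mul_sum]
      have h1 := ih.sum_mul_star
      simp only [h1, mul_one, (isCuntzSystem_cuntzGen n).sum_mul_star]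

/-- The span of the elements `s_μ s_ν⋆`. -/
noncomputable def wordSpan (n : ℕ) : Submodule ℂ (CuntzAlgebra n) :=
  Submodule.span ℂ {x | ∃ l m : List (Fin n), x = cuntzWord l * star (cuntzWord m)}

/-- The span of the elements `s_μ s_ν⋆` with `|μ| = |ν| = k`, a matrix algebra of size `n ^ k`. -/
noncomputable def levelSpan (n k : ℕ) : Submodule ℂ (CuntzAlgebra n) :=
  Submodule.span ℂ {x | ∃ l m : List (Fin n), l.length = k ∧ m.length = k ∧
    x = cuntzWord l * star (cuntzWord m)}

theorem cuntzGen_mul_mem_wordSpan (i : Fin n) {x : CuntzAlgebra n} (hx : x ∈ wordSpan n) :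
    cuntzGen i * x ∈ wordSpan n := by
  induction hx using Submodule.span_induction with
  | mem x hx =>
    obtain ⟨l, m, rfl⟩ := hx
    exact Submodule.subset_span ⟨i :: l, m, by rw [cuntzWord_cons, mul_assoc]⟩
  | zero => simp
  | add x y _ _ hx hy => rw [mul_add]; exact add_mem hx hy
  | smul c x _ hx => rw [mul_smul_comm]; exact Submodule.smul_mem _ c hx

theorem star_cuntzGen_mul_mem_wordSpan (i : Fin n) {x : CuntzAlgebra n} (hx : x ∈ wordSpan n) :
    star (cuntzGen i) * x ∈ wordSpan n := by
  induction hx using Submodule.span_induction with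
  | mem x hx =>
    obtain ⟨l, m, rfl⟩ := hx
    cases l with
    | nil =>
      refine Submodule.subset_span ⟨[], m ++ [i], ?_⟩
      simp [cuntzWord_append, cuntzWord_nil, cuntzWord_cons]
    | cons j l =>
      rw [cuntzWord_cons, mul_assoc, (isCuntzSystem_cuntzGen n).star_mul_mul]
      split_ifs
      · exact Submodule.subset_span ⟨l, m, rfl⟩
      · exact zero_mem _
  | zero => simp
  | add x y _ _ hx hy => rw [mul_add]; exact add_mem hx hy
  | smul c x _ hx => rw [mul_smul_comm]; exact Submodule.smul_mem _ c hx

theorem mem_wordSpan_of_mem_adjoin {x : CuntzAlgebra n}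
    (hx : x ∈ StarAlgebra.adjoin ℂ (Set.range (cuntzGen (n := n)))) : x ∈ wordSpan n := by
  -- the left multipliers of `wordSpan n` form a subalgebra that contains all `s i` and `s i⋆`
  let T : Subalgebra ℂ (CuntzAlgebra n) :=
    { carrier := {a | ∀ y ∈ wordSpan n, a * y ∈ wordSpan n}
      mul_mem' := fun ha hb y hy => by rw [mul_assoc]; exact ha _ (hb _ hy)
      add_mem' := fun ha hb y hy => by rw [add_mul]; exact add_mem (ha _ hy) (hb _ hy)
      algebraMap_mem' := fun c y hy => by
        rw [Algebra.algebraMap_eq_smul_one, smul_mul_assoc, one_mul]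
        exact Submodule.smul_mem _ c hy }
  have hT : Algebra.adjoin ℂ (Set.range (cuntzGen (n := n)) ∪ star (Set.range cuntzGen)) ≤ T := by
    refine Algebra.adjoin_le ?_
    rintro a (⟨i, rfl⟩ | ⟨i, hi⟩)
    · exact fun y hy => cuntzGen_mul_mem_wordSpan i hy
    · rw [← star_star a, ← hi]
      exact fun y hy => star_cuntzGen_mul_mem_wordSpan i hy
  have h1 : (1 : CuntzAlgebra n) ∈ wordSpan n :=
    Submodule.subset_span ⟨[], [], by simp [cuntzWord_nil]⟩
  simpa using hT hx 1 h1

theorem exists_wordSpan_norm_sub_lt (a : CuntzAlgebra n) {ε : ℝ} (hε : 0 < ε) :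
    ∃ x ∈ wordSpan n, ‖a - x‖ < ε := by
  have ha : cuntzIncl n a ∈ closure
      (StarAlgebra.adjoin ℂ (Set.range (universalGen n)) : Set (CuntzAmbient n)) := a.2
  obtain ⟨y, hy, hay⟩ := Metric.mem_closure_iff.mp ha ε hε
  have hr : Set.range (universalGen n) = cuntzIncl n '' Set.range cuntzGen := by
    rw [← Set.range_comp]; rfl
  rw [hr, ← StarAlgHom.map_adjoin] at hy
  obtain ⟨x, hx, rfl⟩ := hy
  refine ⟨x, mem_wordSpan_of_mem_adjoin hx, ?_⟩
  rw [dist_eq_norm] at hay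
  exact hay

theorem levelSpan_mono : Monotone (levelSpan n) := by
  refine monotone_nat_of_le_succ fun k => Submodule.span_le.mpr ?_
  rintro _ ⟨l, m, hl, hm, rfl⟩
  have h : cuntzWord l * star (cuntzWord m) =
      ∑ i, cuntzWord (l ++ [i]) * star (cuntzWord (m ++ [i])) := by
    have h1 : ∀ i : Fin n, cuntzWord (l ++ [i]) * star (cuntzWord (m ++ [i])) =
        cuntzWord l * (cuntzGen i * star (cuntzGen i)) * star (cuntzWord m) := fun i => by
      simp [cuntzWord_append, cuntzWord_nil, cuntzWord_cons, mul_assoc]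
    simp only [h1, ← Finset.sum_mul, ← Finset.mul_sum, (isCuntzSystem_cuntzGen n).sum_mul_star,
      mul_one]
  rw [h]
  exact sum_mem fun i _ => Submodule.subset_span ⟨_, _, by simp [hl], by simp [hm], rfl⟩

theorem exists_matrixHom_of_mem_levelSpan {k : ℕ} {x : CuntzAlgebra n} (hx : x ∈ levelSpan n k) :
    ∃ M, (isCuntzSystem_word n k).matrixHom M = x := by
  have hofFn : ∀ l : List (Fin n), l.length = k → ∃ μ : Fin k → Fin n, List.ofFn μ = l := by
    rintro l rfl
    exact ⟨l.get, List.ofFn_get l⟩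
  have h : levelSpan n k ≤ LinearMap.range
      ((isCuntzSystem_word n k).matrixHom.toAlgHom.toLinearMap) := by
    refine Submodule.span_le.mpr ?_
    rintro _ ⟨l, m, hl, hm, rfl⟩
    obtain ⟨μ, rfl⟩ := hofFn l hl
    obtain ⟨ν, rfl⟩ := hofFn m hm
    exact ⟨Matrix.single μ ν 1, (isCuntzSystem_word n k).matrixHom_single μ ν⟩
  exact h hx

end Words

/-! ### Density of the matrix algebras in the core -/

section Density

variable {n : ℕ}

/-- The average of the gauge action over the `M`-th roots of unity. -/
noncomputable def gaugeAverage (M : ℕ) : CuntzAlgebra n →ₗ[ℂ] CuntzAlgebra n :=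
  (M : ℂ)⁻¹ • ∑ j ∈ Finset.range M,
    (cuntzGauge (Circle.exp (2 * Real.pi / M) ^ j)).toAlgHom.toLinearMap

theorem gaugeAverage_apply (M : ℕ) (x : CuntzAlgebra n) :
    gaugeAverage M x = (M : ℂ)⁻¹ • ∑ j ∈ Finset.range M,
      cuntzGauge (Circle.exp (2 * Real.pi / M) ^ j) x := by
  simp [gaugeAverage]

theorem gaugeAverage_of_fixed {M : ℕ} (hM : M ≠ 0) {x : CuntzAlgebra n}
    (hx : ∀ z : Circle, cuntzGauge z x = x) : gaugeAverage M x = x := by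
  rw [gaugeAverage_apply]
  simp only [hx, Finset.sum_const, Finset.card_range]
  rw [← Nat.cast_smul_eq_nsmul ℂ, smul_smul, inv_mul_cancel₀ (by exact_mod_cast hM), one_smul]

theorem norm_gaugeAverage_le (M : ℕ) (x : CuntzAlgebra n) : ‖gaugeAverage M x‖ ≤ ‖x‖ := by
  rcases eq_or_ne M 0 with rfl | hM
  · simp [gaugeAverage_apply]
  rw [gaugeAverage_apply, norm_smul, norm_inv, Complex.norm_natCast,
    inv_mul_le_iff₀ (by positivity)]
  refine (norm_sum_le_of_le _ fun j _ => NonUnitalStarAlgHom.norm_apply_le _ x).trans_eq ?_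
  simp

theorem cuntzGauge_mul_star {z : Circle} {k m : ℕ} {x y : CuntzAlgebra n}
    (hx : cuntzGauge z x = (z : ℂ) ^ k • x) (hy : cuntzGauge z y = (z : ℂ) ^ m • y) :
    cuntzGauge z (x * star y) = ((z : ℂ) ^ k * star (z : ℂ) ^ m) • (x * star y) := by
  rw [map_mul, map_star, hx, hy, star_smul, smul_mul_smul_comm, star_pow]

theorem isPrimitiveRoot_exp {M : ℕ} (hM : M ≠ 0) :
    IsPrimitiveRoot (Circle.exp (2 * Real.pi / M) : ℂ) M := by
  have h := Complex.isPrimitiveRoot_exp M hM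
  convert h using 1
  rw [Circle.coe_exp]
  congr 1
  push_cast
  ring

/-- The average kills the elements of nonzero degree, if the degree is small. -/
theorem gaugeAverage_word_mul_star_word {M : ℕ} {l m : List (Fin n)} (hl : l.length < M)
    (hm : m.length < M) (hlm : l.length ≠ m.length) :
    gaugeAverage M (cuntzWord l * star (cuntzWord m)) = 0 := by
  have hM : M ≠ 0 := by omega
  set ζ := Circle.exp (2 * Real.pi / M) with hζ0
  have hζ : IsPrimitiveRoot (ζ : ℂ) M := isPrimitiveRoot_exp hM
  have hζ1 : star (ζ : ℂ) * ζ = 1 := circle_star_mul ζ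
  set r : ℂ := (ζ : ℂ) ^ l.length * star (ζ : ℂ) ^ m.length with hr
  have hr1 : r ≠ 1 := fun h => hlm (hζ.pow_inj hl hm (by
    calc (ζ : ℂ) ^ l.length = r * (ζ : ℂ) ^ m.length := by
          rw [hr, mul_assoc, ← mul_pow, hζ1, one_pow, mul_one]
      _ = (ζ : ℂ) ^ m.length := by rw [h, one_mul]))
  have hrM : r ^ M = 1 := by
    rw [hr, mul_pow, ← pow_mul, ← pow_mul, mul_comm l.length, mul_comm m.length, pow_mul, pow_mul,
      ← star_pow, hζ.pow_eq_one]
    simp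
  have h : ∀ j, cuntzGauge (ζ ^ j) (cuntzWord l * star (cuntzWord m)) =
      r ^ j • (cuntzWord l * star (cuntzWord m)) := fun j => by
    rw [cuntzGauge_mul_star (cuntzGauge_word _ l) (cuntzGauge_word _ m), hr, Circle.coe_pow,
      mul_pow, star_pow, pow_right_comm, pow_right_comm (star (ζ : ℂ))]
  rw [gaugeAverage_apply]
  simp only [← hζ0, h, ← Finset.sum_smul]
  rw [geom_sum_eq hr1, hrM, sub_self, zero_div, zero_smul, smul_zero]

theorem gauge_word_mul_star_word_of_length_eq {l m : List (Fin n)} (h : l.length = m.length)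
    (z : Circle) :
    cuntzGauge z (cuntzWord l * star (cuntzWord m)) = cuntzWord l * star (cuntzWord m) := by
  rw [cuntzGauge_mul_star (cuntzGauge_word _ l) (cuntzGauge_word _ m), h, ← mul_pow, mul_comm,
    circle_star_mul, one_pow, one_smul]

/-- On a fixed element of `wordSpan n`, averaging over sufficiently many roots of unity projects to
the part of degree zero. -/
theorem exists_gaugeAverage_mem_levelSpan {x : CuntzAlgebra n} (hx : x ∈ wordSpan n) :
    ∃ N, ∀ M > N, gaugeAverage M x ∈ levelSpan n N := by
  induction hx using Submodule.span_induction with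
  | mem x hx =>
    obtain ⟨l, m, rfl⟩ := hx
    refine ⟨max l.length m.length, fun M hM => ?_⟩
    by_cases h : l.length = m.length
    · rw [gaugeAverage_of_fixed (by omega) (gauge_word_mul_star_word_of_length_eq h)]
      exact Submodule.subset_span ⟨l, m, by omega, by omega, rfl⟩
    · rw [gaugeAverage_word_mul_star_word (by omega) (by omega) h]
      exact zero_mem _
  | zero => exact ⟨0, fun M _ => by simp⟩
  | add x y _ _ hx hy =>
    obtain ⟨N, hN⟩ := hx
    obtain ⟨N', hN'⟩ := hy
    refine ⟨max N N', fun M hM => ?_⟩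
    rw [map_add]
    exact add_mem (levelSpan_mono (le_max_left N N') (hN M (by omega)))
      (levelSpan_mono (le_max_right N N') (hN' M (by omega)))
  | smul c x _ hx =>
    obtain ⟨N, hN⟩ := hx
    exact ⟨N, fun M hM => by rw [map_smul]; exact Submodule.smul_mem _ c (hN M hM)⟩

theorem exists_levelSpan_norm_sub_lt (a : Core n) {ε : ℝ} (hε : 0 < ε) :
    ∃ k, ∃ x ∈ levelSpan n k, ‖coreIncl n a - x‖ < ε := by
  obtain ⟨x, hx, hax⟩ := exists_wordSpan_norm_sub_lt (coreIncl n a) hε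
  obtain ⟨N, hN⟩ := exists_gaugeAverage_mem_levelSpan hx
  refine ⟨N, _, hN (N + 1) (by omega), lt_of_le_of_lt ?_ hax⟩
  have h := gaugeAverage_of_fixed (M := N + 1) (by omega) fun z => cuntzGauge_coreIncl z a
  calc ‖coreIncl n a - gaugeAverage (N + 1) x‖
      = ‖gaugeAverage (N + 1) (coreIncl n a - x)‖ := by rw [map_sub, h]
    _ ≤ _ := norm_gaugeAverage_le _ _

end Density

/-! ### Simplicity and triviality of the centre of the core -/

section Simple

variable {n : ℕ}

theorem norm_coreIncl (a : Core n) : ‖coreIncl n a‖ = ‖a‖ := rfl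

/-- Elements `x`, `y` on which the gauge action is by the same power of `z` multiply the core into
itself, as `a ↦ x a y⋆` and as `a ↦ x⋆ a y`. -/
theorem cuntzGauge_mul_core_mul_star {k : ℕ} {x y : CuntzAlgebra n}
    (hx : ∀ z : Circle, cuntzGauge z x = (z : ℂ) ^ k • x)
    (hy : ∀ z : Circle, cuntzGauge z y = (z : ℂ) ^ k • y) (a : Core n) (z : Circle) :
    cuntzGauge z (x * coreIncl n a * star y) = x * coreIncl n a * star y := by
  rw [map_mul, map_mul, map_star, hx, hy, cuntzGauge_coreIncl, star_smul, smul_mul_assoc,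
    smul_mul_smul_comm, star_pow, ← mul_pow, mul_comm, circle_star_mul, one_pow, one_smul]

theorem cuntzGauge_star_mul_core_mul {k : ℕ} {x y : CuntzAlgebra n}
    (hx : ∀ z : Circle, cuntzGauge z x = (z : ℂ) ^ k • x)
    (hy : ∀ z : Circle, cuntzGauge z y = (z : ℂ) ^ k • y) (a : Core n) (z : Circle) :
    cuntzGauge z (star x * coreIncl n a * y) = star x * coreIncl n a * y := by
  rw [map_mul, map_mul, map_star, hx, hy, cuntzGauge_coreIncl, star_smul, smul_mul_assoc,
    smul_mul_smul_comm, star_pow, ← mul_pow, circle_star_mul, one_pow, one_smul]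

theorem cuntzGauge_comb (k : ℕ) (v : EuclideanSpace ℂ (Fin k → Fin n)) (z : Circle) :
    cuntzGauge z (IsCuntzSystem.comb (fun μ : Fin k → Fin n => cuntzWord (List.ofFn μ)) v) =
      (z : ℂ) ^ k • IsCuntzSystem.comb (fun μ : Fin k → Fin n => cuntzWord (List.ofFn μ)) v := by
  simp only [IsCuntzSystem.comb, map_sum, map_smul, cuntzGauge_word, List.length_ofFn,
    Finset.smul_sum]
  exact Finset.sum_congr rfl fun μ _ => smul_comm _ _ _

theorem norm_star_mul_mul_le {B : Type*} [CStarAlgebra B] {S T : B} (hS : ‖S‖ ≤ 1) (hT : ‖T‖ ≤ 1)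
    (x : B) : ‖star S * x * T‖ ≤ ‖x‖ :=
  calc ‖star S * x * T‖ ≤ ‖star S‖ * ‖x‖ * ‖T‖ := norm_mul₃_le
    _ ≤ 1 * ‖x‖ * 1 := by rw [norm_star]; gcongr
    _ = ‖x‖ := by rw [one_mul, mul_one]

/-- The core is algebraically simple. A nonzero `b` is close to an element `x` of a matrix algebra;
a compression of `x` by contractions is a scalar of absolute value comparable to `‖b‖`, so the same
compression of `b` is invertible. -/
theorem exists_sum_mul_mul_eq_one (hn : n ≠ 0) {b : Core n} (hb : b ≠ 0) :
    ∃ (k : ℕ) (p q : (Fin k → Fin n) → Core n), ∑ μ, p μ * b * q μ = 1 := by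
  have : Nontrivial (Core n) := core_nontrivial hn
  have : Nontrivial (CuntzAlgebra n) := (coreIncl_injective n).nontrivial
  have hb0 : 0 < ‖b‖ := norm_pos_iff.mpr hb
  obtain ⟨k, x, hx, hbx⟩ := exists_levelSpan_norm_sub_lt b (ε := ‖b‖ / 4) (by positivity)
  obtain ⟨M, rfl⟩ := exists_matrixHom_of_mem_levelSpan hx
  set u : (Fin k → Fin n) → CuntzAlgebra n := fun μ => cuntzWord (List.ofFn μ) with hu_def
  have hu : IsCuntzSystem u := isCuntzSystem_word n k
  have hxn : ‖b‖ / 2 < ‖hu.matrixHom M‖ := by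
    have h1 := norm_sub_norm_le (coreIncl n b) (hu.matrixHom M)
    rw [norm_coreIncl] at h1
    linarith
  obtain ⟨v, w, t, hS1, hT1, ht, hvw⟩ := hu.exists_compress_eq_smul_one M (by positivity) hxn
  set S := IsCuntzSystem.comb u v
  set T := IsCuntzSystem.comb u w
  have hS : ∀ z : Circle, cuntzGauge z S = (z : ℂ) ^ k • S := cuntzGauge_comb k v
  have hT : ∀ z : Circle, cuntzGauge z T = (z : ℂ) ^ k • T := cuntzGauge_comb k w
  have hug : ∀ μ, ∀ z : Circle, cuntzGauge z (u μ) = (z : ℂ) ^ k • u μ := fun μ z => by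
    rw [hu_def, cuntzGauge_word, List.length_ofFn]
  let y : Core n := Core.mk (star S * coreIncl n b * T) (cuntzGauge_star_mul_core_mul hS hT b)
  have hyt : ‖y - t • 1‖ < ‖b‖ / 4 := by
    have h1 : coreIncl n (y - t • 1) = star S * (coreIncl n b - hu.matrixHom M) * T := by
      rw [map_sub, coreIncl_mk, map_smul, map_one, ← hvw, mul_sub, sub_mul]
    rw [← norm_coreIncl, h1]
    exact (norm_star_mul_mul_le hS1 hT1 _).trans_lt hbx
  have ht0 : t ≠ 0 := norm_pos_iff.mp (by linarith)
  have hy : IsUnit y := by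
    have h1 := spectrum.mem_resolventSet_of_norm_lt (a := t • 1 - y) (k := t) (by
      rw [norm_sub_rev]; linarith)
    rwa [spectrum.mem_resolventSet_iff, Algebra.algebraMap_eq_smul_one, sub_sub_cancel] at h1
  obtain ⟨y', hy'⟩ := hy.exists_left_inv
  refine ⟨k, fun μ => Core.mk (u μ * coreIncl n y' * star S)
    (cuntzGauge_mul_core_mul_star (hug μ) hS y'),
    fun μ => Core.mk (T * coreIncl n 1 * star (u μ))
    (cuntzGauge_mul_core_mul_star hT (hug μ) 1), coreIncl_injective n ?_⟩
  have hyy : coreIncl n y' * (star S * coreIncl n b * T) = 1 := by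
    rw [← map_one (coreIncl n), ← hy', map_mul]; rfl
  have h : ∀ μ, u μ * coreIncl n y' * star S * coreIncl n b * (T * 1 * star (u μ)) =
      u μ * star (u μ) := fun μ => by
    calc _ = u μ * (coreIncl n y' * (star S * coreIncl n b * T)) * star (u μ) := by
          simp only [mul_assoc, one_mul]
      _ = _ := by rw [hyy, mul_one]
  simp only [map_sum, map_mul, coreIncl_mk, map_one, h, hu.sum_mul_star]

/-- The centre of the core is trivial: a central element minus a point of its spectrum is not
invertible, so it generates a proper ideal. -/
theorem exists_eq_smul_one_of_central (hn : n ≠ 0) {c : Core n} (hc : ∀ a, a * c = c * a) :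
    ∃ t : ℂ, c = t • 1 := by
  have : Nontrivial (Core n) := core_nontrivial hn
  obtain ⟨t, ht⟩ := spectrum.nonempty c
  refine ⟨t, ?_⟩
  by_contra hne
  have hb : algebraMap ℂ (Core n) t - c ≠ 0 := fun h => hne (by
    rw [← Algebra.algebraMap_eq_smul_one]; exact (sub_eq_zero.mp h).symm)
  have hcomm : ∀ a, a * (algebraMap ℂ (Core n) t - c) = (algebraMap ℂ (Core n) t - c) * a :=
    fun a => by rw [mul_sub, sub_mul, hc, Algebra.commutes]
  obtain ⟨k, p, q, h⟩ := exists_sum_mul_mul_eq_one hn hb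
  have h1 : (algebraMap ℂ (Core n) t - c) * ∑ μ, p μ * q μ = 1 := by
    rw [← h, Finset.mul_sum]
    exact Finset.sum_congr rfl fun μ _ => by rw [← mul_assoc, hcomm]
  refine spectrum.mem_iff.mp ht ⟨⟨_, _, h1, ?_⟩, rfl⟩
  rw [hcomm, h1]

end Simple

/-! ### Generalities on Hilbert modules with a finite basis -/

section HilbertModules

variable {A X : Type*} [CStarAlgebra A]

theorem exists_sum_star_mul_self_eq {ι : Type*} (s : Finset ι) (c : ι → A) :
    ∃ b : A, ∑ i ∈ s, star (c i) * c i = star b * b := by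
  let _ : PartialOrder A := CStarAlgebra.spectralOrder A
  have : StarOrderedRing A := CStarAlgebra.spectralOrderedRing A
  exact CStarAlgebra.nonneg_iff_eq_star_mul_self.mp
    (Finset.sum_nonneg fun i _ => star_mul_self_nonneg (c i))

theorem norm_sq_le_norm_sum_star_mul_self {ι : Type*} (s : Finset ι) (c : ι → A) {i : ι}
    (hi : i ∈ s) : ‖c i‖ ^ 2 ≤ ‖∑ j ∈ s, star (c j) * c j‖ := by
  let _ : PartialOrder A := CStarAlgebra.spectralOrder A
  have : StarOrderedRing A := CStarAlgebra.spectralOrderedRing A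
  rw [pow_two, ← CStarRing.norm_star_mul_self]
  exact CStarAlgebra.norm_le_norm_of_nonneg_of_le (star_mul_self_nonneg (c i))
    (Finset.single_le_sum (f := fun j => star (c j) * c j)
      (fun j _ => star_mul_self_nonneg (c j)) hi)

/-- Completeness for a nonnegative function `q` that is equivalent to the square of a complete
norm. -/
theorem exists_limit_of_equiv_norm_sq [NormedAddCommGroup X] [CompleteSpace X] {q : X → ℝ}
    {C D : ℝ} (hq : ∀ x, 0 ≤ q x) (hC : ∀ x, ‖x‖ ^ 2 ≤ C * q x) (hD : ∀ x, q x ≤ D * ‖x‖ ^ 2)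
    (u : ℕ → X) (hu : ∀ ε > 0, ∃ N, ∀ k ≥ N, ∀ l ≥ N, q (u k - u l) < ε) :
    ∃ x : X, ∀ ε > 0, ∃ N, ∀ k ≥ N, q (u k - x) < ε := by
  have hcauchy : CauchySeq u := by
    rw [Metric.cauchySeq_iff]
    intro ε hε
    obtain ⟨N, hN⟩ := hu (ε ^ 2 / (|C| + 1)) (by positivity)
    refine ⟨N, fun k hk l hl => ?_⟩
    have h1 := hN k hk l hl
    rw [lt_div_iff₀ (by positivity)] at h1
    rw [dist_eq_norm]
    refine lt_of_pow_lt_pow_left₀ 2 hε.le ?_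
    nlinarith [hC (u k - u l), mul_le_mul_of_nonneg_right (le_abs_self C) (hq (u k - u l)),
      hq (u k - u l)]
  obtain ⟨x, hx⟩ := cauchySeq_tendsto_of_complete hcauchy
  refine ⟨x, fun ε hε => ?_⟩
  have h0 : Filter.Tendsto (fun k => D * ‖u k - x‖ ^ 2) Filter.atTop (nhds 0) := by
    simpa using ((tendsto_iff_norm_sub_tendsto_zero.mp hx).pow 2).const_mul D
  obtain ⟨N, hN⟩ := Filter.eventually_atTop.mp (h0.eventually (gt_mem_nhds hε))
  exact ⟨N, fun k hk => (hD _).trans_lt (hN k hk)⟩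

/-- A norm-closed set is closed under limits with respect to a function that dominates the square
of the norm. -/
theorem mem_of_isClosed_of_limit [NormedAddCommGroup X] {q : X → ℝ} {C : ℝ} (hq : ∀ x, 0 ≤ q x)
    (hC : ∀ x, ‖x‖ ^ 2 ≤ C * q x) {P : Set X} (hP : IsClosed P) {u : ℕ → X} (hu : ∀ k, u k ∈ P)
    {x : X} (hx : ∀ ε > 0, ∃ N, ∀ k ≥ N, q (u k - x) < ε) : x ∈ P := by
  refine hP.closure_subset (Metric.mem_closure_iff.mpr fun ε hε => ?_)
  obtain ⟨N, hN⟩ := hx (ε ^ 2 / (|C| + 1)) (by positivity)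
  refine ⟨u N, hu N, ?_⟩
  have h1 := hN N le_rfl
  rw [lt_div_iff₀ (by positivity)] at h1
  rw [dist_eq_norm, norm_sub_rev]
  refine lt_of_pow_lt_pow_left₀ 2 hε.le ?_
  nlinarith [hC (u N - x), mul_le_mul_of_nonneg_right (le_abs_self C) (hq (u N - x)),
    hq (u N - x)]

namespace LeftModuleData

theorem IsHilbert.restrict [NormedAddCommGroup X] [NormedSpace ℂ X] {M : LeftModuleData A X}
    (hM : M.IsHilbert) {C : ℝ} (hC : ∀ x, ‖x‖ ^ 2 ≤ C * ‖M.linner x x‖) (P : Submodule ℂ X)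
    (hP : ∀ (a : A), ∀ y ∈ P, M.lsmul a y ∈ P) (hclosed : IsClosed (P : Set X)) :
    (M.restrict P hP).IsHilbert where
  linner_lsmul a x y := hM.linner_lsmul a x y
  star_linner x y := hM.star_linner x y
  linner_nonneg x := hM.linner_nonneg x
  linner_definite x hx := Subtype.ext (hM.linner_definite x hx)
  complete u hu := by
    obtain ⟨x, hx⟩ := hM.complete (fun k => u k) hu
    exact ⟨⟨x, mem_of_isClosed_of_limit (q := fun y => ‖M.linner y y‖) (fun _ => norm_nonneg _) hC
      hclosed (fun k => (u k).2) hx⟩, hx⟩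

variable [AddCommGroup X] [Module ℂ X]

theorem IsBasis.exists_fin {M : LeftModuleData A X} {ι : Type*} [Fintype ι] {u : ι → X}
    (hu : M.IsBasis u) : ∃ (k : ℕ) (v : Fin k → X), M.IsBasis v := by
  let e := Fintype.equivFin ι
  refine ⟨Fintype.card ι, u ∘ e.symm, fun x => ?_⟩
  exact (e.symm.sum_comp fun i => M.lsmul (M.linner x (u i)) (u i)).trans (hu x)

/-- The index does not depend on the basis, if the left action is adjointable for the right form:
`∑ i, ⟨u i | u i⟩ = ∑ i j, ⟨u i | ⟨u i, v j⟩ ▷ v j⟩ = ∑ j i, ⟨⟨v j, u i⟩ ▷ u i | v j⟩`. -/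
theorem IsBasis.hasIndex {M : LeftModuleData A X} (hM : M.IsHilbert) {r : X → X → A}
    (hl : ∀ x x' y, r (x + x') y = r x y + r x' y) (hr : ∀ x y y', r x (y + y') = r x y + r x y')
    (hadj : ∀ a x y, r (M.lsmul a x) y = r x (M.lsmul (star a) y)) {κ : Type*} [Fintype κ]
    {v : κ → X} (hv : M.IsBasis v) : M.HasIndex r (∑ j, r (v j) (v j)) := by
  refine ⟨hv.exists_fin, fun k u hu => ?_⟩
  have hl' : ∀ (f : Fin k → X) y, r (∑ i, f i) y = ∑ i, r (f i) y := fun f y =>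
    map_sum (AddMonoidHom.mk' (fun x => r x y) fun x x' => hl x x' y) f _
  have hr' : ∀ x (f : κ → X), r x (∑ j, f j) = ∑ j, r x (f j) := fun x f =>
    map_sum (AddMonoidHom.mk' (fun y => r x y) (hr x)) f _
  calc ∑ i, r (u i) (u i)
      = ∑ i, r (u i) (∑ j, M.lsmul (M.linner (u i) (v j)) (v j)) := by
        exact Finset.sum_congr rfl fun i _ => by rw [hv (u i)]
    _ = ∑ j, ∑ i, r (M.lsmul (M.linner (v j) (u i)) (u i)) (v j) := by
        simp only [hr', hadj, hM.star_linner]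
        exact Finset.sum_comm
    _ = ∑ j, r (v j) (v j) := by
        simp only [← hl']
        exact Finset.sum_congr rfl fun j _ => by rw [hu (v j)]

end LeftModuleData

namespace RightModuleData

theorem IsHilbert.restrict [NormedAddCommGroup X] [NormedSpace ℂ X] {M : RightModuleData A X}
    (hM : M.IsHilbert) {C : ℝ} (hC : ∀ x, ‖x‖ ^ 2 ≤ C * ‖M.rinner x x‖) (P : Submodule ℂ X)
    (hP : ∀ (a : A), ∀ y ∈ P, M.rsmul (.op a) y ∈ P) (hclosed : IsClosed (P : Set X)) :
    (M.restrict P hP).IsHilbert where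
  rinner_rsmul x y a := hM.rinner_rsmul x y a
  star_rinner x y := hM.star_rinner x y
  rinner_nonneg x := hM.rinner_nonneg x
  rinner_definite x hx := Subtype.ext (hM.rinner_definite x hx)
  complete u hu := by
    obtain ⟨x, hx⟩ := hM.complete (fun k => u k) hu
    exact ⟨⟨x, mem_of_isClosed_of_limit (q := fun y => ‖M.rinner y y‖) (fun _ => norm_nonneg _) hC
      hclosed (fun k => (u k).2) hx⟩, hx⟩

variable [AddCommGroup X] [Module ℂ X]

theorem IsBasis.exists_fin {M : RightModuleData A X} {ι : Type*} [Fintype ι] {u : ι → X}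
    (hu : M.IsBasis u) : ∃ (k : ℕ) (v : Fin k → X), M.IsBasis v := by
  let e := Fintype.equivFin ι
  refine ⟨Fintype.card ι, u ∘ e.symm, fun x => ?_⟩
  exact (e.symm.sum_comp fun i => M.rsmul (.op (M.rinner (u i) x)) (u i)).trans (hu x)

/-- The index does not depend on the basis, if the right action is adjointable for the left form. -/
theorem IsBasis.hasIndex {M : RightModuleData A X} (hM : M.IsHilbert) {l : X → X → A}
    (hl : ∀ x x' y, l (x + x') y = l x y + l x' y) (hr : ∀ x y y', l x (y + y') = l x y + l x y')
    (hadj : ∀ a x y, l (M.rsmul (.op a) x) y = l x (M.rsmul (.op (star a)) y)) {κ : Type*}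
    [Fintype κ] {v : κ → X} (hv : M.IsBasis v) : M.HasIndex l (∑ j, l (v j) (v j)) := by
  refine ⟨hv.exists_fin, fun k u hu => ?_⟩
  have hl' : ∀ (f : Fin k → X) y, l (∑ i, f i) y = ∑ i, l (f i) y := fun f y =>
    map_sum (AddMonoidHom.mk' (fun x => l x y) fun x x' => hl x x' y) f _
  have hr' : ∀ x (f : κ → X), l x (∑ j, f j) = ∑ j, l x (f j) := fun x f =>
    map_sum (AddMonoidHom.mk' (fun y => l x y) (hr x)) f _
  calc ∑ i, l (u i) (u i)
      = ∑ i, l (u i) (∑ j, M.rsmul (.op (M.rinner (v j) (u i))) (v j)) := by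
        exact Finset.sum_congr rfl fun i _ => by rw [hv (u i)]
    _ = ∑ j, ∑ i, l (M.rsmul (.op (M.rinner (u i) (v j))) (u i)) (v j) := by
        simp only [hr', hadj, hM.star_rinner]
        exact Finset.sum_comm
    _ = ∑ j, l (v j) (v j) := by
        simp only [← hl']
        exact Finset.sum_congr rfl fun j _ => by rw [hu (v j)]

end RightModuleData

theorem BimoduleData.IsFgp.restrict [AddCommGroup X] [Module ℂ X] {M : BimoduleData A X}
    (hM : M.IsFgp) (P : Submodule ℂ X) (hl : ∀ (a : A), ∀ y ∈ P, M.lsmul a y ∈ P)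
    (hr : ∀ (a : A), ∀ y ∈ P, M.rsmul (.op a) y ∈ P)
    (left : (M.toLeftModuleData.restrict P hl).IsFgp)
    (right : (M.toRightModuleData.restrict P hr).IsFgp) : (M.restrict P hl hr).IsFgp where
  left := left
  right := right
  smul_comm a b x := Subtype.ext (hM.smul_comm a b x)
  linner_rsmul x y a := hM.linner_rsmul x y a
  rinner_lsmul a x y := hM.rinner_lsmul a x y
  left_le_right := hM.left_le_right.imp fun _ h x => h x
  right_le_left := hM.right_le_left.imp fun _ h x => h x

/-- The summation isomorphism for a decomposition of the identity into projections `π i` with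
ranges `P i`. -/
noncomputable def sumEquivOfProjections {ι : Type*} [Fintype ι] [AddCommGroup X] [Module ℂ X]
    (P : ι → Submodule ℂ X) (π : ι → X →ₗ[ℂ] X) (hmem : ∀ i x, π i x ∈ P i)
    (hself : ∀ i, ∀ x ∈ P i, π i x = x) (hne : ∀ i j, i ≠ j → ∀ x ∈ P j, π i x = 0)
    (hsum : ∀ x, ∑ i, π i x = x) : (∀ i, P i) ≃ₗ[ℂ] X where
  toFun x := ∑ i, (x i : X)
  map_add' x y := by simp [Finset.sum_add_distrib]
  map_smul' c x := by simp [Finset.smul_sum]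
  invFun x i := ⟨π i x, hmem i x⟩
  left_inv x := by
    ext i
    simp only [map_sum]
    rw [Finset.sum_eq_single i (fun j _ hj => hne i j hj.symm _ (x j).2) (by simp),
      hself i _ (x i).2]
  right_inv x := hsum x

end HilbertModules

/-! ### The core as the algebra of matrices over itself -/

section CoreMatrix

variable {n : ℕ}

/-- The entry `s k⋆ a s l` of `a`, for the identification of `A` with `M_n(A)` given by the matrix
units `s k s l⋆` and the endomorphism `λ`. -/
noncomputable def coreEntry (k l : Fin n) : Core n →ₗ[ℂ] Core n where
  toFun a := Core.mk (star (cuntzGen k) * coreIncl n a * cuntzGen l) (star_mul_mem_core k l a)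
  map_add' a b := coreIncl_injective n (by simp [coreIncl_mk, mul_add, add_mul])
  map_smul' c a := coreIncl_injective n (by simp [coreIncl_mk])

theorem coreIncl_coreEntry (k l : Fin n) (a : Core n) :
    coreIncl n (coreEntry k l a) = star (cuntzGen k) * coreIncl n a * cuntzGen l := rfl

theorem coreIncl_coreLambda (a : Core n) :
    coreIncl n (coreLambda n a) = ∑ i, cuntzGen i * coreIncl n a * star (cuntzGen i) := by
  change coreIncl n (∑ i, conjGen i a) = _
  rw [map_sum]; rfl

theorem star_cuntzGen_mul_lambda (k : Fin n) (a : Core n) :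
    star (cuntzGen k) * coreIncl n (coreLambda n a) = coreIncl n a * star (cuntzGen k) := by
  simp [coreIncl_coreLambda, Finset.mul_sum, mul_assoc, (isCuntzSystem_cuntzGen n).star_mul_mul]

theorem lambda_mul_cuntzGen (k : Fin n) (a : Core n) :
    coreIncl n (coreLambda n a) * cuntzGen k = cuntzGen k * coreIncl n a := by
  simp [coreIncl_coreLambda, Finset.sum_mul, mul_assoc, (isCuntzSystem_cuntzGen n).star_mul]

theorem coreEntry_lambda_mul (k l : Fin n) (a x : Core n) :
    coreEntry k l (coreLambda n a * x) = a * coreEntry k l x := coreIncl_injective n (by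
  rw [coreIncl_coreEntry, map_mul, map_mul, ← mul_assoc, star_cuntzGen_mul_lambda,
    coreIncl_coreEntry]
  simp only [mul_assoc])

theorem coreEntry_mul_lambda (k l : Fin n) (a x : Core n) :
    coreEntry k l (x * coreLambda n a) = coreEntry k l x * a := coreIncl_injective n (by
  rw [coreIncl_coreEntry, map_mul, map_mul, mul_assoc, mul_assoc, lambda_mul_cuntzGen,
    coreIncl_coreEntry]
  simp only [mul_assoc])

theorem star_coreEntry (k l : Fin n) (a : Core n) :
    star (coreEntry k l a) = coreEntry l k (star a) := coreIncl_injective n (by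
  simp only [map_star, coreIncl_coreEntry, star_mul, star_star, mul_assoc])

theorem coreEntry_mul (k l : Fin n) (a b : Core n) :
    coreEntry k l (a * b) = ∑ i, coreEntry k i a * coreEntry i l b := coreIncl_injective n (by
  simp only [map_sum, map_mul, coreIncl_coreEntry]
  have h := (isCuntzSystem_cuntzGen n).sum_mul_star_mul (coreIncl n b * cuntzGen l)
  calc _ = star (cuntzGen k) * coreIncl n a * (coreIncl n b * cuntzGen l) := by
        simp only [mul_assoc]
    _ = _ := by
        rw [← h, Finset.mul_sum]
        simp only [mul_assoc])

theorem coreEntry_unitE_mul (i j k l : Fin n) (a : Core n) :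
    coreEntry k l (unitE i j * a) = if k = i then coreEntry j l a else 0 := coreIncl_injective n (by
  rw [coreIncl_coreEntry, map_mul, coreIncl_unitE, mul_assoc, mul_assoc, mul_assoc,
    (isCuntzSystem_cuntzGen n).star_mul_mul]
  split_ifs <;> simp [coreIncl_coreEntry, mul_assoc])

theorem coreEntry_mul_unitE (i j k l : Fin n) (a : Core n) :
    coreEntry k l (a * unitE i j) = if j = l then coreEntry k i a else 0 := coreIncl_injective n (by
  rw [coreIncl_coreEntry, map_mul, coreIncl_unitE, mul_assoc, mul_assoc, mul_assoc,
    (isCuntzSystem_cuntzGen n).star_mul]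
  split_ifs <;> simp [coreIncl_coreEntry, mul_assoc])

theorem coreEntry_unitE (i j k l : Fin n) :
    coreEntry k l (unitE i j) = if k = i ∧ j = l then 1 else 0 := coreIncl_injective n (by
  rw [coreIncl_coreEntry, coreIncl_unitE, mul_assoc, mul_assoc,
    (isCuntzSystem_cuntzGen n).star_mul, (isCuntzSystem_cuntzGen n).star_mul_mul]
  by_cases h1 : k = i <;> by_cases h2 : j = l <;> simp [h1, h2])

theorem lambda_coreEntry_mul_unitE (k l : Fin n) (a : Core n) :
    coreLambda n (coreEntry k l a) * unitE k l = unitE k k * a * unitE l l :=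
  coreIncl_injective n (by
    simp only [map_mul, coreIncl_unitE]
    rw [← mul_assoc, lambda_mul_cuntzGen, coreIncl_coreEntry]
    simp only [mul_assoc])

theorem unitE_mul_unitE (i j k l : Fin n) :
    unitE i j * unitE k l = if j = k then unitE i l else 0 := coreIncl_injective n (by
  simp only [map_mul, coreIncl_unitE]
  rw [mul_assoc, (isCuntzSystem_cuntzGen n).star_mul_mul]
  split_ifs <;> simp [coreIncl_unitE])

theorem star_unitE (i j : Fin n) : star (unitE i j) = unitE j i := coreIncl_injective n (by
  simp only [map_star, coreIncl_unitE, star_mul, star_star])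

theorem sum_unitE_self (n : ℕ) : ∑ i : Fin n, unitE i i = 1 := coreIncl_injective n (by
  simp only [map_sum, coreIncl_unitE, map_one, (isCuntzSystem_cuntzGen n).sum_mul_star])

theorem sum_unitE_mul_mul_unitE (a : Core n) :
    ∑ i, ∑ j, unitE i i * a * unitE j j = a := by
  simp only [← Finset.mul_sum, sum_unitE_self, mul_one, ← Finset.sum_mul, one_mul]

theorem sum_lambda_coreEntry_mul_unitE (a : Core n) :
    ∑ i, ∑ j, coreLambda n (coreEntry i j a) * unitE i j = a := by
  simp only [lambda_coreEntry_mul_unitE, sum_unitE_mul_mul_unitE]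

theorem compressGen_eq_coreEntry (k : Fin n) : compressGen k = coreEntry k k := rfl

/-- The transfer operator is unchanged by the expectation, as `s k⋆ s i s i⋆ = δ_{ki} s k⋆`. -/
theorem coreTransfer_coreExpectation (a : Core n) :
    coreTransfer n (coreExpectation n a) = ∑ k, coreEntry k k a := by
  apply coreIncl_injective n
  simp [coreTransfer, coreExpectation, compressGen_eq_coreEntry, coreIncl_coreEntry,
    coreIncl_conjGen, mul_assoc,
    (isCuntzSystem_cuntzGen n).star_mul, (isCuntzSystem_cuntzGen n).star_mul_mul]

theorem lambdaBimodule_linner (x y : Core n) :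
    (lambdaBimodule n).linner x y = ∑ k, coreEntry k k (x * star y) :=
  coreTransfer_coreExpectation _

theorem lambdaBimodule_rinner (x y : Core n) : (lambdaBimodule n).rinner x y = star x * y := rfl

theorem lambdaBimodule_linner_unitE (x : Core n) (i j : Fin n) :
    (lambdaBimodule n).linner x (unitE i j) = coreEntry i j x := by
  simp [lambdaBimodule_linner, star_unitE, coreEntry_mul_unitE]

theorem lambdaBimodule_linner_self (x : Core n) :
    (lambdaBimodule n).linner x x =
      ∑ p : Fin n × Fin n, star (star (coreEntry p.1 p.2 x)) * star (coreEntry p.1 p.2 x) := by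
  rw [lambdaBimodule_linner, Fintype.sum_prod_type]
  simp only [coreEntry_mul, star_star, star_coreEntry]

end CoreMatrix

/-! ### The bimodule `λA` -/

section LambdaBimodule

variable {n : ℕ}

theorem norm_coreEntry_le (k l : Fin n) (x : Core n) : ‖coreEntry k l x‖ ≤ ‖x‖ := by
  have h1 : ∀ i : Fin n, ‖cuntzGen i‖ ≤ 1 := fun i => by
    have h := CStarRing.norm_star_mul_self (x := cuntzGen i)
    have h2 := CStarRing.norm_star_mul_self (x := (1 : CuntzAlgebra n))
    rw [star_one, one_mul] at h2
    rw [(isCuntzSystem_cuntzGen n).star_mul_self] at h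
    by_contra! hi
    have h3 : 1 < ‖(1 : CuntzAlgebra n)‖ := by nlinarith
    nlinarith
  exact norm_star_mul_mul_le (h1 k) (h1 l) (coreIncl n x)

theorem norm_linner_self_le (x : Core n) :
    ‖(lambdaBimodule n).linner x x‖ ≤ n * ‖x‖ ^ 2 := by
  rw [lambdaBimodule_linner]
  refine (norm_sum_le_of_le _ fun k _ => norm_coreEntry_le k k _).trans_eq ?_
  rw [CStarRing.norm_self_mul_star, ← pow_two]
  simp

theorem norm_coreEntry_sq_le (k l : Fin n) (x : Core n) :
    ‖coreEntry k l x‖ ^ 2 ≤ ‖(lambdaBimodule n).linner x x‖ := by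
  have h := norm_sq_le_norm_sum_star_mul_self Finset.univ
    (fun p : Fin n × Fin n => star (coreEntry p.1 p.2 x)) (Finset.mem_univ (k, l))
  rw [← lambdaBimodule_linner_self] at h
  rwa [← norm_star (coreEntry k l x)]

theorem norm_sq_le_linner_self (x : Core n) :
    ‖x‖ ^ 2 ≤ (∑ p : Fin n × Fin n, ‖unitE p.1 p.2‖) ^ 2 * ‖(lambdaBimodule n).linner x x‖ := by
  set q := ‖(lambdaBimodule n).linner x x‖ with hq
  have hp : ∀ p : Fin n × Fin n,
      ‖coreLambda n (coreEntry p.1 p.2 x) * unitE p.1 p.2‖ ≤ ‖unitE p.1 p.2‖ * √q := fun p => by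
    have h1 : ‖coreLambda n (coreEntry p.1 p.2 x)‖ ≤ √q :=
      (NonUnitalStarAlgHom.norm_apply_le (coreLambda n) (coreEntry p.1 p.2 x)).trans
        (Real.le_sqrt_of_sq_le (norm_coreEntry_sq_le p.1 p.2 x))
    have h2 := norm_mul_le (coreLambda n (coreEntry p.1 p.2 x)) (unitE p.1 p.2)
    have h3 : 0 ≤ ‖unitE p.1 p.2‖ := norm_nonneg _
    nlinarith
  have h : ‖x‖ ≤ (∑ p : Fin n × Fin n, ‖unitE p.1 p.2‖) * √q := by
    have h1 := norm_sum_le_of_le Finset.univ fun p _ => hp p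
    rwa [Fintype.sum_prod_type, sum_lambda_coreEntry_mul_unitE, ← Finset.sum_mul] at h1
  calc ‖x‖ ^ 2 ≤ ((∑ p : Fin n × Fin n, ‖unitE p.1 p.2‖) * √q) ^ 2 :=
        pow_le_pow_left₀ (norm_nonneg x) h 2
    _ = _ := by rw [mul_pow, Real.sq_sqrt (norm_nonneg ((lambdaBimodule n).linner x x))]

theorem norm_rinner_self (x : Core n) : ‖(lambdaBimodule n).rinner x x‖ = ‖x‖ ^ 2 := by
  rw [lambdaBimodule_rinner, CStarRing.norm_star_mul_self, pow_two]

theorem isHilbert_lambda_left (n : ℕ) : (lambdaBimodule n).toLeftModuleData.IsHilbert where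
  linner_lsmul a x y := by
    simp only [lambdaBimodule_linner, lambdaBimodule_lsmul, mul_assoc, coreEntry_lambda_mul,
      Finset.mul_sum]
  star_linner x y := by
    simp only [lambdaBimodule_linner, star_sum, star_coreEntry, star_mul, star_star]
  linner_nonneg x := by
    rw [lambdaBimodule_linner_self]
    exact exists_sum_star_mul_self_eq _ _
  linner_definite x hx := by
    have h := norm_sq_le_linner_self x
    rw [hx, norm_zero, mul_zero] at h
    exact norm_eq_zero.mp (pow_eq_zero_iff two_ne_zero |>.mp (le_antisymm h (sq_nonneg _)))
  complete := exists_limit_of_equiv_norm_sq (fun _ => norm_nonneg _) norm_sq_le_linner_self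
    norm_linner_self_le

theorem isHilbert_lambda_right (n : ℕ) : (lambdaBimodule n).toRightModuleData.IsHilbert where
  rinner_rsmul x y a := (mul_assoc _ _ _).symm
  star_rinner x y := by simp only [lambdaBimodule_rinner, star_mul, star_star]
  rinner_nonneg x := ⟨x, rfl⟩
  rinner_definite x hx := CStarRing.star_mul_self_eq_zero_iff x |>.mp hx
  complete := exists_limit_of_equiv_norm_sq (q := fun x => ‖(lambdaBimodule n).rinner x x‖)
    (C := 1) (D := 1) (fun _ => norm_nonneg _) (fun x => by rw [norm_rinner_self, one_mul])
    fun x => by rw [norm_rinner_self, one_mul]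

theorem isBasis_unitE (n : ℕ) : (lambdaBimodule n).toLeftModuleData.IsBasis
    fun p : Fin n × Fin n => unitE p.1 p.2 := fun x => by
  simp only [lambdaBimodule_linner_unitE, lambdaBimodule_lsmul]
  rw [Fintype.sum_prod_type, sum_lambda_coreEntry_mul_unitE]

theorem isOrthonormal_unitE (n : ℕ) : (lambdaBimodule n).toLeftModuleData.IsOrthonormal
    fun p : Fin n × Fin n => unitE p.1 p.2 := fun p q => by
  rw [lambdaBimodule_linner_unitE, coreEntry_unitE]
  simp only [Prod.ext_iff, eq_comm]

theorem isFgp_lambdaBimodule (n : ℕ) : (lambdaBimodule n).IsFgp where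
  left := ⟨isHilbert_lambda_left n, (isBasis_unitE n).exists_fin⟩
  right := ⟨isHilbert_lambda_right n, 1, fun _ => (1 : Core n), fun x => by
    simp [lambdaBimodule_rsmul, lambdaBimodule_rinner]⟩
  smul_comm a b x := (mul_assoc _ _ _).symm
  linner_rsmul x y a := by
    simp only [lambdaBimodule_linner, lambdaBimodule_rsmul, star_mul, star_star, mul_assoc]
  rinner_lsmul a x y := by
    simp only [lambdaBimodule_rinner, lambdaBimodule_lsmul, star_mul, map_star, mul_assoc]
  left_le_right := ⟨n, fun x => by
    rw [norm_rinner_self]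
    exact norm_linner_self_le x⟩
  right_le_left := ⟨_, fun x => by
    rw [norm_rinner_self]
    exact norm_sq_le_linner_self x⟩

end LambdaBimodule

/-! ### The blocks `A ▷ s j s i⋆` -/

section Blocks

variable {n : ℕ}

theorem mem_cyclic_unitE_iff (j i : Fin n) (y : Core n) :
    y ∈ (lambdaBimodule n).cyclic (unitE j i) ↔ unitE j j * y * unitE i i = y := by
  constructor
  · rintro ⟨a, rfl⟩
    change unitE j j * (coreLambda n a * unitE j i) * unitE i i = coreLambda n a * unitE j i
    rw [← lambda_coreEntry_mul_unitE, coreEntry_lambda_mul, coreEntry_unitE, if_pos ⟨rfl, rfl⟩,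
      mul_one]
  · intro hy
    refine ⟨coreEntry j i y, ?_⟩
    change coreLambda n (coreEntry j i y) * unitE j i = y
    rw [lambda_coreEntry_mul_unitE, hy]

theorem unitE_mem_cyclic (j i : Fin n) : unitE j i ∈ (lambdaBimodule n).cyclic (unitE j i) := by
  rw [mem_cyclic_unitE_iff]
  simp [unitE_mul_unitE]

theorem isHilbert_blockModule (j i : Fin n) : (blockModule (unitE j i)).IsHilbert := by
  refine (isHilbert_lambda_left n).restrict norm_sq_le_linner_self _ _ ?_
  have h : ((lambdaBimodule n).cyclic (unitE j i) : Set (Core n)) =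
      {y | unitE j j * y * unitE i i = y} := Set.ext (mem_cyclic_unitE_iff j i)
  rw [h]
  exact isClosed_eq ((continuous_const_mul (unitE j j)).mul_const (unitE i i)) continuous_id

theorem isBasis_blockModule (j i : Fin n) : (blockModule (unitE j i)).IsBasis
    fun _ : Fin 1 => ⟨unitE j i, unitE_mem_cyclic j i⟩ := fun x => by
  ext
  rw [Fin.sum_univ_one]
  change coreLambda n ((lambdaBimodule n).linner x (unitE j i)) * unitE j i = x
  rw [lambdaBimodule_linner_unitE, lambda_coreEntry_mul_unitE]
  exact (mem_cyclic_unitE_iff j i _).mp x.2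

theorem isFgp_blockModule (j i : Fin n) : (blockModule (unitE j i)).IsFgp :=
  ⟨isHilbert_blockModule j i, (isBasis_blockModule j i).exists_fin⟩

theorem hasIndex_blockModule (j i : Fin n) : (blockModule (unitE j i)).HasIndex
    (fun x y => (lambdaBimodule n).rinner (x : Core n) (y : Core n)) (unitE i i) := by
  have h := (isBasis_blockModule j i).hasIndex (isHilbert_blockModule j i)
    (r := fun x y => (lambdaBimodule n).rinner (x : Core n) (y : Core n))
    (fun x x' y => by simp) (fun x y y' => by simp)
    fun a x y => (isFgp_lambdaBimodule n).rinner_lsmul a x y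
  simpa [lambdaBimodule_rinner, star_unitE, unitE_mul_unitE] using h

/-- The compression `y ↦ s j s j⋆ y s i s i⋆` onto the block `A ▷ s j s i⋆`. -/
noncomputable def blockProjection (p : Fin n × Fin n) : Core n →ₗ[ℂ] Core n :=
  LinearMap.mulLeft ℂ (unitE p.1 p.1) ∘ₗ LinearMap.mulRight ℂ (unitE p.2 p.2)

theorem blockProjection_apply (p : Fin n × Fin n) (y : Core n) :
    blockProjection p y = unitE p.1 p.1 * y * unitE p.2 p.2 := by
  simp [blockProjection, mul_assoc]

theorem blockProjection_blockProjection (p q : Fin n × Fin n) (y : Core n) :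
    blockProjection p (blockProjection q y) = if p = q then blockProjection p y else 0 := by
  have h : unitE p.1 p.1 * (unitE q.1 q.1 * y * unitE q.2 q.2) * unitE p.2 p.2 =
      (unitE p.1 p.1 * unitE q.1 q.1) * y * (unitE q.2 q.2 * unitE p.2 p.2) := by
    simp only [mul_assoc]
  simp only [blockProjection_apply]
  rw [h, unitE_mul_unitE, unitE_mul_unitE]
  by_cases h1 : p.1 = q.1 <;> by_cases h2 : p.2 = q.2 <;> simp [h1, h2, Prod.ext_iff, eq_comm]

theorem mem_cyclic_iff_blockProjection (p : Fin n × Fin n) (y : Core n) :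
    y ∈ (lambdaBimodule n).cyclic (unitE p.1 p.2) ↔ blockProjection p y = y := by
  rw [mem_cyclic_unitE_iff, blockProjection_apply]

/-- Summation of the blocks. -/
noncomputable def blockEquiv (n : ℕ) :
    (∀ p : Fin n × Fin n, (lambdaBimodule n).cyclic (unitE p.1 p.2)) ≃ₗ[ℂ] Core n :=
  sumEquivOfProjections _ blockProjection
    (fun p y => by
      rw [mem_cyclic_iff_blockProjection, blockProjection_blockProjection, if_pos rfl])
    (fun p y hy => (mem_cyclic_iff_blockProjection p y).mp hy)
    (fun p q hpq y hy => by
      rw [← (mem_cyclic_iff_blockProjection q y).mp hy, blockProjection_blockProjection,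
        if_neg hpq])
    (fun y => by
      simp only [blockProjection_apply]
      rw [Fintype.sum_prod_type, sum_unitE_mul_mul_unitE])

theorem blockEquiv_apply
    (x : ∀ p : Fin n × Fin n, (lambdaBimodule n).cyclic (unitE p.1 p.2)) :
    blockEquiv n x = ∑ p, (x p : Core n) := rfl

theorem linner_of_mem_cyclic_ne {p q : Fin n × Fin n} (hpq : p ≠ q) {x y : Core n}
    (hx : x ∈ (lambdaBimodule n).cyclic (unitE p.1 p.2))
    (hy : y ∈ (lambdaBimodule n).cyclic (unitE q.1 q.2)) :
    (lambdaBimodule n).linner x y = 0 := by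
  obtain ⟨a, rfl⟩ := hx
  obtain ⟨b, rfl⟩ := hy
  change (lambdaBimodule n).linner ((lambdaBimodule n).lsmul a _)
    ((lambdaBimodule n).lsmul b _) = 0
  rw [(isHilbert_lambda_left n).linner_lsmul, ← (isHilbert_lambda_left n).star_linner,
    (isHilbert_lambda_left n).linner_lsmul, isOrthonormal_unitE n q p, if_neg hpq.symm]
  simp

theorem isUnitary_blockEquiv (n : ℕ) :
    (LeftModuleData.directSum fun p : Fin n × Fin n => blockModule (unitE p.1 p.2)).IsUnitary
      (lambdaBimodule n).toLeftModuleData (blockEquiv n) := by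
  constructor
  · intro a x
    rw [blockEquiv_apply, blockEquiv_apply, map_sum]
    rfl
  · intro x y
    rw [blockEquiv_apply, blockEquiv_apply, map_sum (lambdaBimodule n).linner,
      LinearMap.sum_apply]
    refine Finset.sum_congr rfl fun p _ => ?_
    rw [map_sum, Finset.sum_eq_single p
      (fun q _ hq => linner_of_mem_cyclic_ne hq.symm (x p).2 (y q).2) (by simp)]
    rfl

end Blocks

/-! ### The bimodules `(s i s i⋆) A` -/

section Corners

variable {n : ℕ}

theorem mem_corner_iff (i : Fin n) (x : Core n) : x ∈ corner i ↔ unitE i i * x = x := by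
  constructor
  · rintro ⟨y, rfl⟩
    rw [LinearMap.mulLeft_apply, ← mul_assoc, unitE_mul_unitE, if_pos rfl]
  · intro hx
    exact ⟨x, hx⟩

theorem unitE_mem_corner (i k : Fin n) : unitE i k ∈ corner i := by
  rw [mem_corner_iff, unitE_mul_unitE, if_pos rfl]

theorem isClosed_corner (i : Fin n) : IsClosed (corner i : Set (Core n)) := by
  have h : (corner i : Set (Core n)) = {x | unitE i i * x = x} := Set.ext (mem_corner_iff i)
  rw [h]
  exact isClosed_eq (continuous_const_mul (unitE i i)) continuous_id

theorem isHilbert_corner_left (i : Fin n) :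
    (cornerBimodule i).toLeftModuleData.IsHilbert :=
  (isHilbert_lambda_left n).restrict norm_sq_le_linner_self _ _ (isClosed_corner i)

theorem isHilbert_corner_right (i : Fin n) :
    (cornerBimodule i).toRightModuleData.IsHilbert :=
  (isHilbert_lambda_right n).restrict (C := 1)
    (fun x => by rw [norm_rinner_self, one_mul]) _ (rsmul_mem_corner i) (isClosed_corner i)

theorem isBasis_corner_left (i : Fin n) : (cornerBimodule i).toLeftModuleData.IsBasis
    fun k : Fin n => ⟨unitE i k, unitE_mem_corner i k⟩ := fun x => by
  ext
  rw [Submodule.coe_sum]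
  change ∑ k, coreLambda n ((lambdaBimodule n).linner x (unitE i k)) * unitE i k = x
  simp only [lambdaBimodule_linner_unitE, lambda_coreEntry_mul_unitE]
  rw [← Finset.mul_sum, sum_unitE_self, mul_one]
  exact (mem_corner_iff i _).mp x.2

theorem isBasis_corner_right (i : Fin n) : (cornerBimodule i).toRightModuleData.IsBasis
    fun _ : Fin 1 => ⟨unitE i i, unitE_mem_corner i i⟩ := fun x => by
  ext
  rw [Fin.sum_univ_one]
  change unitE i i * (star (unitE i i) * x) = x
  rw [star_unitE, (mem_corner_iff i _).mp x.2, (mem_corner_iff i _).mp x.2]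

theorem isFgp_cornerBimodule (i : Fin n) : (cornerBimodule i).IsFgp :=
  (isFgp_lambdaBimodule n).restrict _ _ _
    ⟨isHilbert_corner_left i, (isBasis_corner_left i).exists_fin⟩
    ⟨isHilbert_corner_right i, (isBasis_corner_right i).exists_fin⟩

theorem hasIndex_corner_left (i : Fin n) : (cornerBimodule i).toLeftModuleData.HasIndex
    (fun x y => (cornerBimodule i).rinner x y) 1 := by
  have h := (isBasis_corner_left i).hasIndex (isHilbert_corner_left i)
    (r := fun x y => (cornerBimodule i).rinner x y)
    (fun x x' y => by simp) (fun x y y' => by simp)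
    fun a x y => (isFgp_cornerBimodule i).rinner_lsmul a x y
  have h1 : ∑ k, star (unitE i k) * unitE i k = 1 := by
    simp [star_unitE, unitE_mul_unitE, sum_unitE_self]
  exact h1 ▸ h

theorem hasIndex_corner_right (i : Fin n) : (cornerBimodule i).toRightModuleData.HasIndex
    (fun x y => (cornerBimodule i).linner x y) 1 := by
  have h := (isBasis_corner_right i).hasIndex (isHilbert_corner_right i)
    (l := fun x y => (cornerBimodule i).linner x y)
    (fun x x' y => by simp) (fun x y y' => by simp)
    fun a x y => (isFgp_cornerBimodule i).linner_rsmul x y a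
  have h1 : ∑ _k : Fin 1, (lambdaBimodule n).linner (unitE i i) (unitE i i) = 1 := by
    rw [Fin.sum_univ_one, lambdaBimodule_linner_unitE, coreEntry_unitE, if_pos ⟨rfl, rfl⟩]
  exact h1 ▸ h

/-- Summation of the corners. -/
noncomputable def cornerEquiv (n : ℕ) : (∀ i : Fin n, corner i) ≃ₗ[ℂ] Core n :=
  sumEquivOfProjections _ (fun i => LinearMap.mulLeft ℂ (unitE i i))
    (fun _ y => ⟨y, rfl⟩)
    (fun i y hy => (mem_corner_iff i y).mp hy)
    (fun i j hij y hy => by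
      rw [LinearMap.mulLeft_apply, ← (mem_corner_iff j y).mp hy, ← mul_assoc, unitE_mul_unitE,
        if_neg hij, zero_mul])
    (fun y => by
      simp only [LinearMap.mulLeft_apply]
      rw [← Finset.sum_mul, sum_unitE_self, one_mul])

theorem cornerEquiv_apply (x : ∀ i : Fin n, corner i) :
    cornerEquiv n x = ∑ i, (x i : Core n) := rfl

theorem linner_of_mem_corner_ne {i j : Fin n} (hij : i ≠ j) {x y : Core n} (hx : x ∈ corner i)
    (hy : y ∈ corner j) : (lambdaBimodule n).linner x y = 0 := by
  rw [lambdaBimodule_linner, ← (mem_corner_iff i x).mp hx, ← (mem_corner_iff j y).mp hy, star_mul,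
    star_unitE]
  refine Finset.sum_eq_zero fun k _ => ?_
  rw [← mul_assoc, coreEntry_mul_unitE, mul_assoc, coreEntry_unitE_mul]
  split_ifs with h1 h2
  · exact absurd (h2.symm.trans h1.symm) hij
  all_goals rfl

theorem rinner_of_mem_corner_ne {i j : Fin n} (hij : i ≠ j) {x y : Core n} (hx : x ∈ corner i)
    (hy : y ∈ corner j) : (lambdaBimodule n).rinner x y = 0 := by
  rw [lambdaBimodule_rinner, ← (mem_corner_iff i x).mp hx, ← (mem_corner_iff j y).mp hy, star_mul,
    star_unitE, mul_assoc, ← mul_assoc (unitE i i), unitE_mul_unitE, if_neg hij, zero_mul, mul_zero]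

theorem isUnitary_cornerEquiv (n : ℕ) :
    (BimoduleData.directSum fun i : Fin n => cornerBimodule i).IsUnitary (lambdaBimodule n)
      (cornerEquiv n) := by
  refine ⟨⟨fun a x => ?_, fun x y => ?_⟩, fun a x => ?_, fun x y => ?_⟩
  · rw [cornerEquiv_apply, cornerEquiv_apply, map_sum]
    rfl
  · rw [cornerEquiv_apply, cornerEquiv_apply, map_sum (lambdaBimodule n).linner,
      LinearMap.sum_apply]
    refine Finset.sum_congr rfl fun i _ => ?_
    rw [map_sum, Finset.sum_eq_single i
      (fun j _ hj => linner_of_mem_corner_ne hj.symm (x i).2 (y j).2) (by simp)]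
    rfl
  · rw [cornerEquiv_apply, cornerEquiv_apply, map_sum]
    rfl
  · rw [cornerEquiv_apply, cornerEquiv_apply, map_sum (lambdaBimodule n).rinner,
      LinearMap.sum_apply]
    refine Finset.sum_congr rfl fun i _ => ?_
    rw [map_sum, Finset.sum_eq_single i
      (fun j _ hj => rinner_of_mem_corner_ne hj.symm (x i).2 (y j).2) (by simp)]
    rfl

/-- Every nonzero `ξ` in `(s i s i⋆) A` generates this bimodule: `s i⋆ ξ ξ⋆ s i` is a nonzero element
of the simple algebra `A`, so that `∑ p (s i⋆ ξ ξ⋆ s i) q = 1` for some `p`, `q`. Conjugation by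
`s i` yields `∑ λ(p) ξ ξ⋆ (s i q s i⋆) = s i s i⋆`. -/
theorem generated_corner_eq_top (i : Fin n) {ξ : corner i} (hξ : ξ ≠ 0) :
    (cornerBimodule i).generated ξ = ⊤ := by
  have hn : n ≠ 0 := (Fin.pos i).ne'
  obtain ⟨ξ, hmem⟩ := ξ
  have hi := (mem_corner_iff i ξ).mp hmem
  have hd : coreEntry i i (ξ * star ξ) ≠ 0 := by
    intro h0
    have h1 : ξ * star ξ = 0 := by
      have h2 := lambda_coreEntry_mul_unitE i i (ξ * star ξ)
      have h3 : star ξ * unitE i i = star ξ := by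
        rw [← star_unitE i i, ← star_mul, hi]
      rw [h0, map_zero, zero_mul, ← mul_assoc, hi, mul_assoc, h3] at h2
      exact h2.symm
    exact hξ (Subtype.ext (CStarRing.mul_star_self_eq_zero_iff ξ |>.mp h1))
  obtain ⟨k, p, q, hpq⟩ := exists_sum_mul_mul_eq_one hn hd
  have hone : ∑ μ, coreLambda n (p μ) * ξ * (star ξ * (coreLambda n (q μ) * unitE i i)) =
      unitE i i := by
    have h1 : ∀ μ, coreLambda n (p μ) * ξ * (star ξ * (coreLambda n (q μ) * unitE i i)) =
        coreLambda n (p μ * coreEntry i i (ξ * star ξ) * q μ) * unitE i i := fun μ => by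
      have h2 : coreLambda n (p μ) * ξ * (star ξ * (coreLambda n (q μ) * unitE i i)) =
          coreLambda n (p μ) * (unitE i i * (ξ * star ξ) * unitE i i) * coreLambda n (q μ) := by
        rw [coreLambda_mul_unitE, ← mul_assoc (unitE i i) ξ, hi]
        simp only [mul_assoc]
      rw [h2, ← lambda_coreEntry_mul_unitE i i (ξ * star ξ), map_mul (coreLambda n),
        map_mul (coreLambda n)]
      rw [mul_assoc _ _ (unitE i i), coreLambda_mul_unitE i (q μ)]
      simp only [mul_assoc]
    simp only [h1, ← Finset.sum_mul, ← map_sum, hpq, map_one, one_mul]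
  rw [eq_top_iff]
  rintro ⟨x, hx⟩ -
  have hx' : (⟨x, hx⟩ : corner i) = ∑ μ, (cornerBimodule i).rsmul
      (.op (star ξ * (coreLambda n (q μ) * unitE i i) * x))
      ((cornerBimodule i).lsmul (p μ) ⟨ξ, hmem⟩) := by
    ext
    rw [Submodule.coe_sum]
    change x = ∑ μ, coreLambda n (p μ) * ξ * (star ξ * (coreLambda n (q μ) * unitE i i) * x)
    conv_lhs => rw [← (mem_corner_iff i x).mp hx, ← hone, Finset.sum_mul]
    simp only [mul_assoc]
  rw [hx']
  exact sum_mem fun μ _ => Submodule.subset_span ⟨_, _, rfl⟩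

end Corners

/-! ### Bimodular endomorphisms -/

section Endomorphisms

variable {n : ℕ}

/-- The entries of an element that commutes with `λ(A)` are central, hence scalars. -/
theorem exists_coreEntry_eq_smul_one {t : Core n}
    (ht : ∀ a, coreLambda n a * t = t * coreLambda n a) (k l : Fin n) :
    ∃ c : ℂ, coreEntry k l t = c • 1 :=
  exists_eq_smul_one_of_central (Fin.pos k).ne' fun a => by
    rw [← coreEntry_lambda_mul, ht, coreEntry_mul_lambda]

theorem isIrreducible_cornerBimodule (i : Fin n) : (cornerBimodule i).IsIrreducible := by
  have : Nontrivial (Core n) := core_nontrivial (Fin.pos i).ne'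
  have he : (unitE i i : Core n) ≠ 0 := fun h => by
    have h1 := coreEntry_unitE i i i i
    rw [h, map_zero, if_pos ⟨rfl, rfl⟩] at h1
    exact zero_ne_one h1
  let e : corner i := ⟨unitE i i, unitE_mem_corner i i⟩
  refine ⟨⟨e, 0, fun h => he (congrArg Subtype.val h)⟩, eq_bot_iff.mpr ?_⟩
  rintro T ⟨⟨hl, hr⟩, -⟩
  have hT : ∀ x : corner i, (T x : Core n) = T e * x := fun x => by
    have h1 : x = (cornerBimodule i).rsmul (.op (x : Core n)) e :=
      Subtype.ext ((mem_corner_iff i _).mp x.2).symm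
    conv_lhs => rw [h1, hr]
    rfl
  have hcomm : ∀ a, coreLambda n a * (T e : Core n) = T e * coreLambda n a := fun a => by
    have h1 : (cornerBimodule i).lsmul a e = (cornerBimodule i).rsmul (.op (coreLambda n a)) e :=
      Subtype.ext (coreLambda_mul_unitE i a)
    have h2 := hl a e
    rw [h1, hr] at h2
    exact (congrArg Subtype.val h2).symm
  obtain ⟨c, hc⟩ := exists_coreEntry_eq_smul_one hcomm i i
  have hTe : (T e : Core n) = c • unitE i i := by
    have h1 := lambda_coreEntry_mul_unitE i i (T e : Core n)
    have h2 : (T e : Core n) * unitE i i = T e := (hT e).symm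
    rw [hc, map_smul, map_one, smul_mul_assoc, one_mul, (mem_corner_iff i _).mp (T e).2, h2] at h1
    exact h1.symm
  refine Algebra.mem_bot.mpr ⟨c, LinearMap.ext fun x => Subtype.ext ?_⟩
  rw [hT x, hTe, smul_mul_assoc, (mem_corner_iff i _).mp x.2]
  rfl

theorem mem_relCommutant_iff {t : Core n} :
    t ∈ relCommutant n ↔ ∀ a, coreLambda n a * t = t * coreLambda n a := by
  rw [relCommutant, StarSubalgebra.mem_centralizer_iff]
  constructor
  · exact fun h a => (h _ ⟨a, rfl⟩).1
  · rintro h _ ⟨a, rfl⟩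
    exact ⟨h a, by rw [← map_star, h]⟩

theorem lambda_mul_unitE (i j : Fin n) (a : Core n) :
    coreLambda n a * unitE i j = unitE i j * coreLambda n a := coreIncl_injective n (by
  rw [map_mul, map_mul, coreIncl_unitE, ← mul_assoc, lambda_mul_cuntzGen, mul_assoc, mul_assoc,
    star_cuntzGen_mul_lambda])

/-- The relative commutant of `λ(A)` is spanned by the matrix units. -/
theorem exists_eq_sum_smul_unitE {t : Core n} (ht : t ∈ relCommutant n) :
    ∃ M : Matrix (Fin n) (Fin n) ℂ, t = ∑ i, ∑ j, M i j • unitE i j := by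
  choose M hM using exists_coreEntry_eq_smul_one (mem_relCommutant_iff.mp ht)
  refine ⟨M, ?_⟩
  conv_lhs => rw [← sum_lambda_coreEntry_mul_unitE t]
  simp only [hM, map_smul, map_one, smul_mul_assoc, one_mul]

theorem coreIncl_sum_smul_unitE (M : Matrix (Fin n) (Fin n) ℂ) :
    coreIncl n (∑ i, ∑ j, M i j • unitE i j) = (isCuntzSystem_cuntzGen n).matrixHom M := by
  simp only [map_sum, map_smul, coreIncl_unitE, IsCuntzSystem.matrixHom_apply]

/-- The `*`-homomorphism `M_n(ℂ) → A`, `M ↦ ∑ i j, M i j s i s j⋆`. -/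
noncomputable def matrixToCore (n : ℕ) : Matrix (Fin n) (Fin n) ℂ →⋆ₐ[ℂ] Core n :=
  (isCuntzSystem_cuntzGen n).matrixHom.codRestrict (coreSubalgebra n) fun M z => by
    rw [← coreIncl_sum_smul_unitE, cuntzGauge_coreIncl]

theorem matrixToCore_apply (M : Matrix (Fin n) (Fin n) ℂ) :
    matrixToCore n M = ∑ i, ∑ j, M i j • unitE i j :=
  coreIncl_injective n (coreIncl_sum_smul_unitE M).symm

theorem matrixToCore_mem_relCommutant (M : Matrix (Fin n) (Fin n) ℂ) :
    matrixToCore n M ∈ relCommutant n := by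
  rw [mem_relCommutant_iff, matrixToCore_apply]
  intro a
  simp only [Finset.mul_sum, Finset.sum_mul, mul_smul_comm, smul_mul_assoc, lambda_mul_unitE]

/-- The `*`-homomorphism `M_n(ℂ) → λ(A)' ∩ A`. -/
noncomputable def matrixToRelCommutant (n : ℕ) :
    Matrix (Fin n) (Fin n) ℂ →⋆ₐ[ℂ] relCommutant n :=
  (matrixToCore n).codRestrict (relCommutant n) matrixToCore_mem_relCommutant

theorem bijective_matrixToRelCommutant (hn : n ≠ 0) :
    Function.Bijective (matrixToRelCommutant n) := by
  have : Nontrivial (Core n) := core_nontrivial hn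
  have : Nontrivial (CuntzAlgebra n) := (coreIncl_injective n).nontrivial
  constructor
  · intro M N h
    have h1 : (isCuntzSystem_cuntzGen n).matrixHom M = (isCuntzSystem_cuntzGen n).matrixHom N :=
      congrArg (fun t : relCommutant n => coreIncl n t) h
    ext k l
    have h2 := (isCuntzSystem_cuntzGen n).compress_matrixHom M k l
    rw [h1, IsCuntzSystem.compress_matrixHom] at h2
    exact (smul_left_injective ℂ one_ne_zero h2).symm
  · rintro ⟨t, ht⟩
    obtain ⟨M, rfl⟩ := exists_eq_sum_smul_unitE ht
    exact ⟨M, Subtype.ext (matrixToCore_apply M)⟩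

theorem matrixToCore_single (j i : Fin n) : matrixToCore n (Matrix.single j i 1) = unitE j i :=
  coreIncl_injective n ((isCuntzSystem_cuntzGen n).matrixHom_single j i)

/-- The map `a ↦ ∑ k, s k⋆ a s k` is tracial against elements of the relative commutant, as these
are combinations of the matrix units. -/
theorem sum_coreEntry_mul_comm {t : Core n} (ht : t ∈ relCommutant n) (a : Core n) :
    ∑ k, coreEntry k k (t * a) = ∑ k, coreEntry k k (a * t) := by
  obtain ⟨M, rfl⟩ := exists_eq_sum_smul_unitE ht
  simp only [Finset.sum_mul, Finset.mul_sum, smul_mul_assoc, mul_smul_comm, map_sum, map_smul]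
  simp only [coreEntry_unitE_mul, coreEntry_mul_unitE]
  rw [Finset.sum_comm]
  conv_rhs => rw [Finset.sum_comm]
  refine Finset.sum_congr rfl fun i _ => ?_
  rw [Finset.sum_comm]
  conv_rhs => rw [Finset.sum_comm]
  exact Finset.sum_congr rfl fun j _ => by simp

theorem isLeftAdjoint_mulLeft {t : Core n} (ht : t ∈ relCommutant n) :
    (lambdaBimodule n).IsLeftAdjoint (LinearMap.mulLeft ℂ t) (LinearMap.mulLeft ℂ (star t)) :=
  fun x y => by
    simp only [lambdaBimodule_linner, LinearMap.mulLeft_apply, star_mul, star_star]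
    rw [mul_assoc, sum_coreEntry_mul_comm ht, mul_assoc]

theorem isRightAdjoint_mulLeft (t : Core n) :
    (lambdaBimodule n).IsRightAdjoint (LinearMap.mulLeft ℂ t) (LinearMap.mulLeft ℂ (star t)) :=
  fun x y => by
    simp only [lambdaBimodule_rinner, LinearMap.mulLeft_apply, star_mul, mul_assoc]

theorem mulLeft_mem_endDag {t : Core n} (ht : t ∈ relCommutant n) :
    LinearMap.mulLeft ℂ t ∈ (lambdaBimodule n).endDag := by
  refine ⟨⟨fun a x => ?_, fun a x => (mul_assoc _ _ _).symm⟩, ⟨_, isLeftAdjoint_mulLeft ht⟩,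
    ⟨_, isRightAdjoint_mulLeft t⟩⟩
  simp only [lambdaBimodule_lsmul, LinearMap.mulLeft_apply, ← mul_assoc,
    mem_relCommutant_iff.mp ht a]

/-- A bimodular endomorphism of `λA` is left multiplication by its value at `1`. -/
theorem exists_mulLeft_eq_of_mem_bimodEnd {T : Module.End ℂ (Core n)}
    (hT : T ∈ (lambdaBimodule n).bimodEnd) : ∃ t ∈ relCommutant n, LinearMap.mulLeft ℂ t = T := by
  obtain ⟨hl, hr⟩ := hT
  have h : ∀ x, T 1 * x = T x := fun x => by
    have h1 := hr x 1
    rw [lambdaBimodule_rsmul, lambdaBimodule_rsmul, one_mul] at h1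
    exact h1.symm
  refine ⟨T 1, mem_relCommutant_iff.mpr fun a => ?_, LinearMap.ext h⟩
  have h1 := hl a 1
  rw [lambdaBimodule_lsmul, lambdaBimodule_lsmul, mul_one, ← h] at h1
  exact h1.symm

theorem bimodEnd_eq_endDag (n : ℕ) : (lambdaBimodule n).bimodEnd = (lambdaBimodule n).endDag :=
  le_antisymm
    (fun T hT => by
      obtain ⟨t, ht, rfl⟩ := exists_mulLeft_eq_of_mem_bimodEnd hT
      exact mulLeft_mem_endDag ht)
    fun _ hT => hT.1

/-- The action of `λ(A)' ∩ A` on `λA` by left multiplication. -/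
noncomputable def relCommutantToEndDag (n : ℕ) :
    relCommutant n →ₐ[ℂ] (lambdaBimodule n).endDag :=
  ((Algebra.lmul ℂ (Core n)).comp (relCommutant n).subtype.toAlgHom).codRestrict _
    fun t => mulLeft_mem_endDag t.2

theorem relCommutantToEndDag_apply (t : relCommutant n) (x : Core n) :
    (relCommutantToEndDag n t : Module.End ℂ (Core n)) x = (t : Core n) * x := rfl

theorem bijective_relCommutantToEndDag (n : ℕ) : Function.Bijective (relCommutantToEndDag n) := by
  constructor
  · intro t t' h
    have h1 := congrArg (fun T : (lambdaBimodule n).endDag =>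
      (T : Module.End ℂ (Core n)) 1) h
    simp only [relCommutantToEndDag_apply, mul_one] at h1
    exact Subtype.ext h1
  · rintro ⟨T, hT⟩
    obtain ⟨t, ht, rfl⟩ := exists_mulLeft_eq_of_mem_bimodEnd hT.1
    exact ⟨⟨t, ht⟩, rfl⟩

end Endomorphisms

theorem proposition3p3 (n : ℕ) (hn : 2 ≤ n) :
    -- `λA` is a finitely generated projective Hilbert bimodule
    (lambdaBimodule n).IsFgp ∧
    -- the left basis `s j s i⋆` is orthonormal
    ((lambdaBimodule n).toLeftModuleData.IsBasis
        (fun p : Fin n × Fin n => unitE p.1 p.2) ∧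
      (lambdaBimodule n).toLeftModuleData.IsOrthonormal
        (fun p : Fin n × Fin n => unitE p.1 p.2) ∧
      -- each block `A ▷ s j s i⋆` is fgp with left index `s i s i⋆`
      (∀ i j : Fin n, (blockModule (unitE j i)).IsFgp ∧
        (blockModule (unitE j i)).HasIndex
          (fun x y => (lambdaBimodule n).rinner (x : Core n) (y : Core n)) (unitE i i)) ∧
      -- `λA` is the orthogonal direct sum of the blocks
      ∃ U : (∀ p : Fin n × Fin n, (lambdaBimodule n).cyclic (unitE p.1 p.2)) ≃ₗ[ℂ] Core n,
        (∀ x, U x = ∑ p, (x p : Core n)) ∧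
        (LeftModuleData.directSum fun p : Fin n × Fin n => blockModule (unitE p.1 p.2)).IsUnitary
          (lambdaBimodule n).toLeftModuleData U) ∧
    -- the bimodules `(s i s i⋆) A`
    ((∀ i : Fin n, (cornerBimodule i).IsFgp ∧ (cornerBimodule i).IsIrreducible ∧
        (cornerBimodule i).toLeftModuleData.HasIndex
          (fun x y => (cornerBimodule i).rinner x y) 1 ∧
        (cornerBimodule i).toRightModuleData.HasIndex
          (fun x y => (cornerBimodule i).linner x y) 1) ∧
      ∃ U : (∀ i : Fin n, corner i) ≃ₗ[ℂ] Core n,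
        (∀ x, U x = ∑ i, (x i : Core n)) ∧
        (BimoduleData.directSum fun i : Fin n => cornerBimodule i).IsUnitary
          (lambdaBimodule n) U) ∧
    -- bimodular endomorphisms are adjointable, and `End†(λA) ≅ λ[A]' ∩ A ≅ M_n(ℂ)` as *-algebras
    ((lambdaBimodule n).bimodEnd = (lambdaBimodule n).endDag ∧
      (∃ Φ : relCommutant n ≃ₐ[ℂ] (lambdaBimodule n).endDag,
        (∀ (t : relCommutant n) (x : Core n), (Φ t : Module.End ℂ (Core n)) x = (t : Core n) * x) ∧
        ∀ t : relCommutant n, (lambdaBimodule n).IsLeftAdjoint (Φ t) (Φ (star t)) ∧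
          (lambdaBimodule n).IsRightAdjoint (Φ t) (Φ (star t))) ∧
      ∃ Ψ : relCommutant n ≃⋆ₐ[ℂ] Matrix (Fin n) (Fin n) ℂ,
        ∀ i j : Fin n, ((Ψ.symm (Matrix.single j i 1) : relCommutant n) : Core n) = unitE j i) ∧
    -- every nonzero vector of `(s i s i⋆) A` generates it algebraically
    (∀ (i : Fin n) (ξ : corner i), ξ ≠ 0 → (cornerBimodule i).generated ξ = ⊤) := by
  have hn0 : n ≠ 0 := by omega
  refine ⟨isFgp_lambdaBimodule n,
    ⟨isBasis_unitE n, isOrthonormal_unitE n,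
      fun i j => ⟨isFgp_blockModule j i, hasIndex_blockModule j i⟩,
      blockEquiv n, blockEquiv_apply, isUnitary_blockEquiv n⟩,
    ⟨fun i => ⟨isFgp_cornerBimodule i, isIrreducible_cornerBimodule i, hasIndex_corner_left i,
      hasIndex_corner_right i⟩, cornerEquiv n, cornerEquiv_apply, isUnitary_cornerEquiv n⟩,
    ⟨bimodEnd_eq_endDag n,
      ⟨AlgEquiv.ofBijective (relCommutantToEndDag n) (bijective_relCommutantToEndDag n),
        relCommutantToEndDag_apply,
        fun t => ⟨isLeftAdjoint_mulLeft t.2, isRightAdjoint_mulLeft t.1⟩⟩,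
      (StarAlgEquiv.ofBijective (matrixToRelCommutant n) (bijective_matrixToRelCommutant hn0)).symm,
      fun i j => matrixToCore_single j i⟩,
    fun i ξ hξ => generated_corner_eq_top i hξ⟩
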